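/- All graphs are simple and undirected, and $\perp$ denotes adjacency. A bichromatic graph is a graph each of whose vertices is declared to be either short or long; isomorphisms and automorphisms of bichromatic graphs preserve this distinction. The local graph of $\Gamma$ at a vertex $x$ is the induced bichromatic graph on the set $x^\perp$ of neighbors of $x$. Let $W(F_4)$ be the Weyl group of the root system of type $F_4$ in $\mathbb{R}^4$, with short roots $\pm e_i$, $\tfrac12(\pm e_1\pm e_2\pm e_3\pm e_4)$ and long roots $\pm e_i\pm e_j$ ($i\neq j$), and let $Z$ be its center. The Weyl graph $\mathbb{W}(F_4)$ is the bichromatic graph whose vertices are the $24$ reflections of $W(F_4)$, two distinct reflections being adjacent if and only if they commute, and where a reflection is a short (respectively long) vertex if it is the reflection through a short (respectively long) root. The twisted copy $\mathbb{W}(F_4)'$ is obtained from $\mathbb{W}(F_4)$ by choosing a short $4$-clique $x_1,x_2,x_3,x_4$ and a long $4$-clique $y_1,y_2,y_3,y_4$ whose mutual adjacencies are exactly $x_1,x_2\perp y_1,y_2$ and $x_3,x_4\perp y_3,y_4$, and replacing these adjacencies by $x_1,x_2\perp y_3,y_4$ and $x_3,x_4\perp y_1,y_2$; up to isomorphism the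 choice does not matter (for definiteness take the $x_i$ to be the reflections through $e_1,e_2,e_3,e_4$ and the $y_j$ the reflections through $e_3-e_4,\ e_3+e_4,\ e_1-e_2,\ e_1+e_2$). A bichromatic graph $\Gamma$ is locally like $\mathbb{W}(F_4)$ if its local graphs at short (respectively long) vertices are isomorphic, as bichromatic graphs, to the local graphs of $\mathbb{W}(F_4)$ at short (respectively long) vertices. It is tightly connected if every long vertex has a neighbor in every short component (connected component of the subgraph induced on the short vertices), and every short vertex has a neighbor in every long component. **Theorem.** Let $\Gamma$ be a connected bichromatic graph (not assumed finite) that is locally like $\mathbb{W}(F_4)$. Assume that at least one of the following holds: - $\Gamma$ has exactly $24$ vertices; - $\Gamma$ is tightly connected; - $\Gamma$ has diameter $2$; - $\mu=3$, that is, any two vertices of $\Gamma$ that are both short or both long and are at distance $2$ have exactly $3$ common neighbors. Then $\Gamma$ is isomorphic, as a bichromatic graph, to $\mathbb{W}(F_4)$ or to its twisted copy $\mathbb{W}(F_4)'$. Moreover, $\operatorname{Aut}(\Gamma)\cong W(F_4)/Z$, where $\operatorname{Aut}(\Gamma)$ is the group of automorphisms of the bichromatic graph $\Gamma$. -/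

import Mathlib

open scoped InnerProductSpace

noncomputable section

/-- A bichromatic graph on the vertex type `V`: a simple undirected graph, each vertex of which is
either short or long. -/
structure BichromaticGraph (V : Type*) where
  /-- the underlying simple graph -/
  graph : SimpleGraph V
  /-- the set of short vertices -/
  IsShort : V → Prop

namespace BichromaticGraph

/-- A vertex is long if it is not short. -/
def IsLong {V : Type*} (Γ : BichromaticGraph V) (v : V) : Prop := ¬ Γ.IsShort v

/-- Two vertices have the same type (both short or both long). -/
def SameType {V : Type*} (Γ : BichromaticGraph V) (u v : V) : Prop :=
  Γ.IsShort u ↔ Γ.IsShort v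

/-- Isomorphism of bichromatic graphs: a graph isomorphism preserving the types of vertices. -/
def IsIsomorphic {V W : Type*} (Γ : BichromaticGraph V) (Δ : BichromaticGraph W) : Prop :=
  ∃ e : Γ.graph ≃g Δ.graph, ∀ v, Δ.IsShort (e v) ↔ Γ.IsShort v

/-- The group (under composition) of type preserving automorphisms of a bichromatic graph. -/
def aut {V : Type*} (Γ : BichromaticGraph V) : Subgroup (Γ.graph ≃g Γ.graph) where
  carrier := {e | ∀ v, Γ.IsShort (e v) ↔ Γ.IsShort v}
  one_mem' := fun _ => Iff.rfl
  mul_mem' := fun {a b} ha hb v => (ha (b v)).trans (hb v)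
  inv_mem' := fun {a} ha v => by
    have h := ha (a.symm v)
    rw [RelIso.apply_symm_apply] at h
    exact h.symm

/-- The induced bichromatic graph on a set of vertices. -/
def induce {V : Type*} (Γ : BichromaticGraph V) (s : Set V) : BichromaticGraph s where
  graph := Γ.graph.induce s
  IsShort := fun v => Γ.IsShort v

/-- The local graph at `v`: the induced bichromatic graph on the neighbors of `v`. -/
def localGraph {V : Type*} (Γ : BichromaticGraph V) (v : V) :
    BichromaticGraph (Γ.graph.neighborSet v) :=
  Γ.induce (Γ.graph.neighborSet v)

/-- `Γ` is locally like `Δ`: the local graphs at short vertices of `Γ` are isomorphic, as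
bichromatic graphs, to those at short vertices of `Δ`, and likewise for long vertices. -/
def LocallyLike {V W : Type*} (Γ : BichromaticGraph V) (Δ : BichromaticGraph W) : Prop :=
  ∀ (v : V) (w : W), (Γ.IsShort v ↔ Δ.IsShort w) → (Γ.localGraph v).IsIsomorphic (Δ.localGraph w)

/-- Every long vertex has a neighbor in every short component (connected component of the induced
subgraph on the short vertices), and every short vertex has a neighbor in every long component. -/
def TightlyConnected {V : Type*} (Γ : BichromaticGraph V) : Prop :=
  (∀ v, Γ.IsLong v → ∀ C : (Γ.graph.induce {w | Γ.IsShort w}).ConnectedComponent,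
    ∃ w ∈ C.supp, Γ.graph.Adj v w) ∧
  (∀ v, Γ.IsShort v → ∀ C : (Γ.graph.induce {w | Γ.IsLong w}).ConnectedComponent,
    ∃ w ∈ C.supp, Γ.graph.Adj v w)

/-- The number `μ(u, v)` of common neighbors of `u` and `v`. -/
def mu {V : Type*} (Γ : BichromaticGraph V) (u v : V) : ℕ :=
  (Γ.graph.commonNeighbors u v).ncard

/-- A short `4`-clique `x₀, x₁, x₂, x₃` and a long `4`-clique `y₀, y₁, y₂, y₃` such that the
adjacencies between them are exactly `x₀, x₁ ⊥ y₀, y₁` and `x₂, x₃ ⊥ y₂, y₃`. -/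
structure StrongPair {V : Type*} (Γ : BichromaticGraph V) where
  /-- the short clique -/
  x : Fin 4 → V
  /-- the long clique -/
  y : Fin 4 → V
  short_x : ∀ i, Γ.IsShort (x i)
  long_y : ∀ i, Γ.IsLong (y i)
  clique_x : ∀ i j, i ≠ j → Γ.graph.Adj (x i) (x j)
  clique_y : ∀ i j, i ≠ j → Γ.graph.Adj (y i) (y j)
  adj_iff : ∀ i j, Γ.graph.Adj (x i) (y j) ↔ (i < 2 ↔ j < 2)

/-- The twisted copy of `Γ` with respect to a pair of cliques as in `StrongPair`: the adjacencies
`x₀, x₁ ⊥ y₀, y₁` and `x₂, x₃ ⊥ y₂, y₃` between the two cliques are replaced by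
`x₀, x₁ ⊥ y₂, y₃` and `x₂, x₃ ⊥ y₀, y₁`; everything else is unchanged. -/
def twistedCopy {V : Type*} (Γ : BichromaticGraph V) (p : Γ.StrongPair) : BichromaticGraph V where
  graph :=
    { Adj := fun u v =>
        (Γ.graph.Adj u v ∧ ¬ ∃ i j, (u = p.x i ∧ v = p.y j) ∨ (v = p.x i ∧ u = p.y j)) ∨
        (∃ i j, ¬ (i < 2 ↔ j < 2) ∧ ((u = p.x i ∧ v = p.y j) ∨ (v = p.x i ∧ u = p.y j)))
      symm := by
        constructor
        rintro u v (⟨h, h'⟩ | ⟨i, j, h, h'⟩)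
        · exact Or.inl ⟨h.symm, fun ⟨i, j, hij⟩ => h' ⟨i, j, hij.symm⟩⟩
        · exact Or.inr ⟨i, j, h, h'.symm⟩
      loopless := by
        constructor
        rintro u (⟨h, -⟩ | ⟨i, j, -, ⟨h, h'⟩ | ⟨h, h'⟩⟩)
        · exact h.ne rfl
        all_goals exact p.long_y j (h' ▸ h ▸ p.short_x i) }
  IsShort := Γ.IsShort

end BichromaticGraph

/-- The commuting graph of a group `G` on a subset `X`: two distinct elements of `X` are adjacent
whenever they commute. -/
def commutingGraph {G : Type*} [Group G] (X : Set G) : SimpleGraph X where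
  Adj g h := g ≠ h ∧ Commute (g : G) (h : G)
  symm := ⟨fun _ _ h => ⟨h.1.symm, h.2.symm⟩⟩
  loopless := ⟨fun _ h => h.1 rfl⟩

namespace F4

/-- The Euclidean space `ℝ⁴`. -/
abbrev E : Type := EuclideanSpace ℝ (Fin 4)

/-- The standard basis vectors of `ℝ⁴`. -/
abbrev e (i : Fin 4) : E := EuclideanSpace.single i (1 : ℝ)

/-- The `24` short roots of the root system of type `F₄`: `± eᵢ` and `½ (± e₀ ± e₁ ± e₂ ± e₃)`. -/
def shortRoots : Set E :=
  {v | (∃ i, v = e i ∨ v = - e i) ∨ ∀ i, v i = 1 / 2 ∨ v i = - (1 / 2)}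

/-- The `24` long roots of the root system of type `F₄`: `± eᵢ ± eⱼ` with `i ≠ j`. -/
def longRoots : Set E :=
  {v | ∃ i j, i ≠ j ∧ (v = e i + e j ∨ v = e i - e j ∨ v = - e i - e j)}

/-- The reflection of `ℝ⁴` in the hyperplane orthogonal to `a`. -/
def refl (a : E) : E ≃ₗᵢ[ℝ] E := (ℝ ∙ a)ᗮ.reflection

/-- The Weyl group `W(F₄)`, generated by the reflections through the roots. -/
def weylGroup : Subgroup (E ≃ₗᵢ[ℝ] E) :=
  Subgroup.closure {g | ∃ a ∈ shortRoots ∪ longRoots, g = refl a}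

/-- The short root reflections in `W(F₄)`. -/
def IsShortReflection (g : weylGroup) : Prop := ∃ a ∈ shortRoots, (g : E ≃ₗᵢ[ℝ] E) = refl a

/-- The long root reflections in `W(F₄)`. -/
def IsLongReflection (g : weylGroup) : Prop := ∃ a ∈ longRoots, (g : E ≃ₗᵢ[ℝ] E) = refl a

/-- The set of reflections in `W(F₄)`. -/
def reflections : Set weylGroup := {g | IsShortReflection g ∨ IsLongReflection g}

/-- The Weyl graph of type `F₄`: the commuting graph of `W(F₄)` on its reflections, in which the
short vertices are the short root reflections. -/
def weylGraph : BichromaticGraph reflections where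
  graph := commutingGraph reflections
  IsShort := fun g => IsShortReflection g

/-! Elementary facts on commuting reflections. -/

theorem refl_apply (a v : E) : refl a v = v - (2 * (⟪a, v⟫_ℝ / ⟪a, a⟫_ℝ)) • a := by
  rw [refl, Submodule.reflection_orthogonal_apply, Submodule.reflection_singleton_apply]
  rw [real_inner_self_eq_norm_sq]
  simp only [RCLike.ofReal_real_eq_id, id_eq, neg_sub]
  rw [mul_smul, two_smul ℝ, two_nsmul]

theorem refl_self (a : E) : refl a a = -a :=
  Submodule.reflection_orthogonalComplement_singleton_eq_neg a

theorem commute_of_inner_eq_zero {a b : E} (h : ⟪a, b⟫_ℝ = 0) :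
    Commute (refl a) (refl b) := by
  have h' : ⟪b, a⟫_ℝ = 0 := by rw [real_inner_comm]; exact h
  apply LinearIsometryEquiv.ext
  intro v
  change refl a (refl b v) = refl b (refl a v)
  simp only [refl_apply, inner_sub_right, inner_smul_right, h, h', mul_zero, sub_zero]
  abel

theorem refl_ne_of_inner_eq_zero {a b : E} (h : ⟪a, b⟫_ℝ = 0) (hb : b ≠ 0) :
    refl a ≠ refl b := by
  intro hab
  have h1 : refl a b = -b := by rw [hab, refl_self]
  rw [refl_apply, h] at h1
  simp only [zero_div, mul_zero, zero_smul, sub_zero] at h1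
  have h2 : (2 : ℝ) • b = 0 := by rw [two_smul]; nth_rewrite 1 [h1]; exact neg_add_cancel b
  exact hb ((smul_eq_zero.mp h2).resolve_left two_ne_zero)

theorem inner_eq_zero_of_commute {a b : E} (hc : Commute (refl a) (refl b))
    (hb : b ≠ 0) (hne : ⟪a, b⟫_ℝ ^ 2 ≠ ⟪a, a⟫_ℝ * ⟪b, b⟫_ℝ) : ⟪a, b⟫_ℝ = 0 := by
  by_contra h
  have hbb : ⟪b, b⟫_ℝ ≠ 0 := inner_self_ne_zero.mpr hb
  have h1 : refl a (refl b a) = refl b (refl a a) := DFunLike.congr_fun hc a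
  rw [refl_self, map_neg, refl_apply a, refl_apply b] at h1
  have hba : ⟪b, a⟫_ℝ = ⟪a, b⟫_ℝ := real_inner_comm _ _
  rw [hba] at h1
  set k : ℝ := 2 * (⟪a, b⟫_ℝ / ⟪b, b⟫_ℝ) with hk
  have hk0 : k ≠ 0 := mul_ne_zero two_ne_zero (div_ne_zero h hbb)
  set t : ℝ := 2 * (⟪a, a - k • b⟫_ℝ / ⟪a, a⟫_ℝ) with ht
  have h2 : (2 - t) • a = (2 * k) • b := by
    have h3 : (2 - t) • a - (2 * k) • b = (a - k • b - t • a) - -(a - k • b) := by module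
    rw [h1, sub_self] at h3
    exact sub_eq_zero.mp h3
  have ha' := congrArg (fun w => ⟪a, w⟫_ℝ) h2
  have hb' := congrArg (fun w => ⟪b, w⟫_ℝ) h2
  simp only [inner_smul_right, hba] at ha' hb'
  apply hne
  have : k * (⟪a, b⟫_ℝ ^ 2 - ⟪a, a⟫_ℝ * ⟪b, b⟫_ℝ) = 0 := by
    linear_combination (-⟪a, b⟫_ℝ / 2) * ha' + (⟪a, a⟫_ℝ / 2) * hb'
  rcases mul_eq_zero.mp this with h4 | h4
  · exact absurd h4 hk0
  · exact sub_eq_zero.mp h4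

/-- The reflection through a short root, as a vertex of the Weyl graph. -/
def shortVertex (a : E) (ha : a ∈ shortRoots) : reflections :=
  ⟨⟨refl a, Subgroup.subset_closure ⟨a, Or.inl ha, rfl⟩⟩, Or.inl ⟨a, ha, rfl⟩⟩

/-- The reflection through a long root, as a vertex of the Weyl graph. -/
def longVertex (a : E) (ha : a ∈ longRoots) : reflections :=
  ⟨⟨refl a, Subgroup.subset_closure ⟨a, Or.inr ha, rfl⟩⟩, Or.inr ⟨a, ha, rfl⟩⟩

theorem adj_iff (u v : reflections) : weylGraph.graph.Adj u v ↔
    (((u : weylGroup) : E ≃ₗᵢ[ℝ] E) ≠ ((v : weylGroup) : E ≃ₗᵢ[ℝ] E) ∧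
      Commute ((u : weylGroup) : E ≃ₗᵢ[ℝ] E) ((v : weylGroup) : E ≃ₗᵢ[ℝ] E)) := by
  change (u ≠ v ∧ Commute (u : weylGroup) (v : weylGroup)) ↔ _
  simp only [Commute, SemiconjBy, ne_eq, Subtype.ext_iff, Subgroup.coe_mul]

/-- The four mutually orthogonal long roots `e₂ - e₃`, `e₂ + e₃`, `e₀ - e₁`, `e₀ + e₁`. -/
def longFrame : Fin 4 → E := ![e 2 - e 3, e 2 + e 3, e 0 - e 1, e 0 + e 1]

theorem e_mem (i : Fin 4) : e i ∈ shortRoots := Or.inl ⟨i, Or.inl rfl⟩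

theorem longFrame_mem (j : Fin 4) : longFrame j ∈ longRoots := by
  fin_cases j
  · exact ⟨2, 3, by decide, Or.inr (Or.inl rfl)⟩
  · exact ⟨2, 3, by decide, Or.inl rfl⟩
  · exact ⟨0, 1, by decide, Or.inr (Or.inl rfl)⟩
  · exact ⟨0, 1, by decide, Or.inl rfl⟩

theorem inner_eq_sum (a b : E) :
    ⟪a, b⟫_ℝ = a 0 * b 0 + a 1 * b 1 + a 2 * b 2 + a 3 * b 3 := by
  rw [PiLp.inner_apply, Fin.sum_univ_four]
  simp only [RCLike.inner_apply, conj_trivial]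
  ring

theorem inner_e_e (i j : Fin 4) : ⟪e i, e j⟫_ℝ = if i = j then 1 else 0 := by
  rw [inner_eq_sum]
  fin_cases i <;> fin_cases j <;> simp

theorem inner_longFrame (i j : Fin 4) :
    ⟪longFrame i, longFrame j⟫_ℝ = if i = j then 2 else 0 := by
  rw [inner_eq_sum]
  fin_cases i <;> fin_cases j <;> simp [longFrame] <;> norm_num

theorem inner_e_longFrame_eq_zero_iff (i j : Fin 4) :
    ⟪e i, longFrame j⟫_ℝ = 0 ↔ (i < 2 ↔ j < 2) := by
  rw [inner_eq_sum]
  fin_cases i <;> fin_cases j <;> simp [longFrame]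

theorem inner_e_longFrame_sq_ne (i j : Fin 4) :
    ⟪e i, longFrame j⟫_ℝ ^ 2 ≠ 2 := by
  rw [inner_eq_sum]
  fin_cases i <;> fin_cases j <;> simp [longFrame]

theorem longFrame_ne_zero (j : Fin 4) : longFrame j ≠ 0 := by
  intro h
  have := inner_longFrame j j
  rw [h, inner_zero_left, if_pos rfl] at this
  norm_num at this

/-- A long root reflection is not a short root reflection. -/
theorem longVertex_isLong (j : Fin 4) :
    weylGraph.IsLong (longVertex (longFrame j) (longFrame_mem j)) := by
  rintro ⟨a, ha, h⟩
  change refl (longFrame j) = refl a at h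
  have h0 := longFrame_ne_zero j
  have h1 : refl a (longFrame j) = - longFrame j := by rw [← h, refl_self]
  rw [refl_apply] at h1
  set c : ℝ := ⟪a, longFrame j⟫_ℝ / ⟪a, a⟫_ℝ with hc
  have h2 : longFrame j = c • a := by
    have h3 : (2 : ℝ) • (longFrame j - c • a) = 0 := by
      have h4 : (2 : ℝ) • (longFrame j - c • a) =
        (longFrame j - (2 * c) • a) - -(longFrame j) := by module
      rw [h4, h1, sub_self]
    exact sub_eq_zero.mp ((smul_eq_zero.mp h3).resolve_left two_ne_zero)
  rcases ha with ⟨i, rfl | rfl⟩ | ha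
  · fin_cases j <;> fin_cases i <;>
      (have g0 := congrArg (fun v : E => v 0) h2
       have g1 := congrArg (fun v : E => v 1) h2
       have g2 := congrArg (fun v : E => v 2) h2
       have g3 := congrArg (fun v : E => v 3) h2
       simp [longFrame] at g0 g1 g2 g3)
  · fin_cases j <;> fin_cases i <;>
      (have g0 := congrArg (fun v : E => v 0) h2
       have g1 := congrArg (fun v : E => v 1) h2
       have g2 := congrArg (fun v : E => v 2) h2
       have g3 := congrArg (fun v : E => v 3) h2
       simp [longFrame] at g0 g1 g2 g3)
  · have hz : ∀ i, a i ≠ 0 := fun i => by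
      rcases ha i with h | h <;> rw [h] <;> norm_num
    have hc0 : c = 0 := by
      fin_cases j
      · have g := congrArg (fun v : E => v 0) h2
        simpa [longFrame, hz 0] using g
      · have g := congrArg (fun v : E => v 0) h2
        simpa [longFrame, hz 0] using g
      · have g := congrArg (fun v : E => v 2) h2
        simpa [longFrame, hz 2] using g
      · have g := congrArg (fun v : E => v 2) h2
        simpa [longFrame, hz 2] using g
    rw [hc0, zero_smul] at h2
    exact h0 h2

/-- The reflections through `e₀, e₁, e₂, e₃` and those through `e₂ ± e₃`, `e₀ ± e₁` form a pair of
cliques along which the Weyl graph of type `F₄` can be twisted. -/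
def standardPair : weylGraph.StrongPair where
  x := fun i => shortVertex (e i) (e_mem i)
  y := fun j => longVertex (longFrame j) (longFrame_mem j)
  short_x := fun i => ⟨e i, e_mem i, rfl⟩
  long_y := longVertex_isLong
  clique_x := fun i j hij => by
    have h : ⟪e i, e j⟫_ℝ = 0 := by rw [inner_e_e, if_neg hij]
    refine (adj_iff _ _).mpr ⟨refl_ne_of_inner_eq_zero h ?_, commute_of_inner_eq_zero h⟩
    simp
  clique_y := fun i j hij => by
    have h : ⟪longFrame i, longFrame j⟫_ℝ = 0 := by rw [inner_longFrame, if_neg hij]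
    exact (adj_iff _ _).mpr
      ⟨refl_ne_of_inner_eq_zero h (longFrame_ne_zero j), commute_of_inner_eq_zero h⟩
  adj_iff := fun i j => by
    rw [← inner_e_longFrame_eq_zero_iff]
    refine (adj_iff _ _).trans ⟨fun h => ?_, fun h =>
      ⟨refl_ne_of_inner_eq_zero h (longFrame_ne_zero j), commute_of_inner_eq_zero h⟩⟩
    refine inner_eq_zero_of_commute h.2 (longFrame_ne_zero j) ?_
    rw [inner_longFrame, inner_e_e, if_pos rfl, if_pos rfl, one_mul]
    exact inner_e_longFrame_sq_ne i j

/-- The twisted copy of the Weyl graph of type `F₄`. -/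
def twistedWeylGraph : BichromaticGraph reflections := weylGraph.twistedCopy standardPair

end F4

end

noncomputable section

/-! ### Integral labels for the reflections, and the model graphs. -/

namespace F4

/-! The local structure makes "equal, or adjacent of the same type" an equivalence relation (`Rel`)
with classes of size four. A vertex has six neighbors of the other type; they form three adjacent
pairs lying in three distinct classes, and each pair is shared with exactly one further vertex of
its own class (`exists_three`). So wherever two opposite classes meet, neighbors come in pairs on
both sides.

Each of the four hypotheses serves only to prove `Tight`: every vertex has a neighbor in every class
of the other type. There are then three short and three long classes. Each opposite class splits a
given class into two halves of size two, and the three opposite classes induce its three different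
splittings (`exists_parallel`). Hence each class is an affine plane over the field with two
elements, whose parallel classes are indexed by the opposite classes. In coordinates, a point of the
`i`-th short plane and a point of the `j`-th long plane are adjacent when the `j`-th linear form of
the first plus the `i`-th linear form of the second equals a constant `c i j` (`exists_coordinates`,
`isIsomorphic_model`). All the freedom is in the binary matrix `c`.

Moving the origins changes `c` by matrices with zero row sums plus matrices with zero column sums.
Together these are all matrices of total sum zero, so `c` matters only through the parity of its
entries (`model_isIsomorphic_of_parity_eq`). Even parity gives the Weyl graph. Twisting flips a
single entry, so odd parity gives the twisted copy.

As nine is odd, the all-ones matrix also represents the twisted copy. It differs from the zero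
matrix by complementing all adjacencies between short and long vertices, so both graphs have the
same automorphisms. For the Weyl graph, conjugation by the Weyl group has the center as kernel, and
a stabilizer chain along a base of four vertices shows that it gives every automorphism
(`conjAut_surjective`). -/

/-- The vertices of the combinatorial model: type (`true` is short), component, and the
coordinates of a point in the affine plane of order `2`. -/
abbrev Model : Type := Bool × Fin 3 × Bool × Bool

/-- The three linear forms on the affine plane of order `2`; their sum vanishes. -/
def form (j : Fin 3) (a b : Bool) : Bool :=
  match j with
  | 0 => a
  | 1 => b
  | 2 => a ^^ b

/-- Boolean adjacency of the combinatorial model twisted by the matrix `c`. -/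
def modelAdj (c : Fin 3 → Fin 3 → Bool) (u v : Model) : Bool :=
  match u, v with
  | (true, i, p, q), (true, j, r, s) => i == j && !(p == r && q == s)
  | (false, i, p, q), (false, j, r, s) => i == j && !(p == r && q == s)
  | (true, i, p, q), (false, j, r, s) => (form j p q ^^ form i r s) == c i j
  | (false, j, r, s), (true, i, p, q) => (form j p q ^^ form i r s) == c i j

theorem modelAdj_comm (c : Fin 3 → Fin 3 → Bool) (u v : Model) :
    modelAdj c u v = modelAdj c v u := by
  obtain ⟨_ | _, i, p, q⟩ := u <;> obtain ⟨_ | _, j, r, s⟩ := v <;>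
    simp [modelAdj, Bool.beq_comm]

theorem modelAdj_self (c : Fin 3 → Fin 3 → Bool) (u : Model) : modelAdj c u u = false := by
  obtain ⟨_ | _, i, p, q⟩ := u <;> simp [modelAdj]

/-- The combinatorial model twisted by the matrix `c`: three short and three long affine planes of
order `2`, each of them a clique; the lines of the `j`-th parallel class of the `i`-th short plane
are matched with the lines of the `i`-th parallel class of the `j`-th long plane. -/
def model (c : Fin 3 → Fin 3 → Bool) : BichromaticGraph Model where
  graph :=
    { Adj := fun u v => modelAdj c u v = true
      symm := ⟨fun u v h => by rwa [modelAdj_comm]⟩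
      loopless := ⟨fun u h => by simp [modelAdj_self] at h⟩ }
  IsShort := fun u => u.1 = true

/-- Twice a positive root, in integer coordinates. -/
def root : Model → Fin 4 → ℤ
  | (false, 0, false, false) => ![0, 0, 2, -2]
  | (false, 0, false, true) => ![0, 0, 2, 2]
  | (false, 0, true, false) => ![2, -2, 0, 0]
  | (false, 0, true, true) => ![2, 2, 0, 0]
  | (false, 1, false, false) => ![0, 2, 0, -2]
  | (false, 1, false, true) => ![0, 2, 0, 2]
  | (false, 1, true, false) => ![2, 0, -2, 0]
  | (false, 1, true, true) => ![2, 0, 2, 0]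
  | (false, 2, false, false) => ![0, 2, -2, 0]
  | (false, 2, false, true) => ![0, 2, 2, 0]
  | (false, 2, true, false) => ![2, 0, 0, -2]
  | (false, 2, true, true) => ![2, 0, 0, 2]
  | (true, 0, false, false) => ![2, 0, 0, 0]
  | (true, 0, false, true) => ![0, 2, 0, 0]
  | (true, 0, true, false) => ![0, 0, 2, 0]
  | (true, 0, true, true) => ![0, 0, 0, 2]
  | (true, 1, false, false) => ![1, 1, 1, 1]
  | (true, 1, false, true) => ![1, 1, -1, -1]
  | (true, 1, true, false) => ![1, -1, 1, -1]
  | (true, 1, true, true) => ![1, -1, -1, 1]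
  | (true, 2, false, false) => ![1, -1, -1, -1]
  | (true, 2, false, true) => ![1, -1, 1, 1]
  | (true, 2, true, false) => ![1, 1, -1, 1]
  | (true, 2, true, true) => ![1, 1, 1, -1]

/-- Twice a positive root, as a vector. -/
def rootVec (m : Model) : E := WithLp.toLp 2 fun k => (root m k : ℝ)

@[simp] theorem rootVec_apply (m : Model) (k : Fin 4) : rootVec m k = (root m k : ℝ) := rfl

/-- The scalar product of integer vectors. -/
def rootDot (m n : Model) : ℤ :=
  root m 0 * root n 0 + root m 1 * root n 1 + root m 2 * root n 2 + root m 3 * root n 3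

theorem inner_rootVec (m n : Model) : ⟪rootVec m, rootVec n⟫_ℝ = (rootDot m n : ℝ) := by
  rw [inner_eq_sum]; simp [rootDot]

/-- The labelling in `root` is chosen so that this holds with the zero matrix. Doubling the roots
keeps all coordinates integral, so a finite check suffices. -/
theorem rootDot_eq_zero_iff : ∀ m n : Model, m ≠ n →
    (rootDot m n = 0 ↔ modelAdj (fun _ _ => false) m n = true) := by
  decide +kernel

/-- Different labels carry non-proportional roots, so Cauchy–Schwarz is strict. This is the
nondegeneracy needed to pass from commuting reflections to orthogonal roots. -/
theorem rootDot_sq_ne : ∀ m n : Model, m ≠ n →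
    rootDot m n ^ 2 ≠ rootDot m m * rootDot n n := by
  decide +kernel

theorem rootDot_self_ne : ∀ m : Model, rootDot m m ≠ 0 := by
  decide +kernel

theorem rootVec_ne_zero (m : Model) : rootVec m ≠ 0 := by
  intro h
  have h1 := inner_rootVec m m
  rw [h, inner_zero_left] at h1
  exact rootDot_self_ne m (by exact_mod_cast h1.symm)

theorem refl_smul {c : ℝ} (hc : c ≠ 0) (a : E) : refl (c • a) = refl a := by
  unfold refl
  congr 2
  exact Submodule.span_singleton_smul_eq (IsUnit.mk0 c hc) a

theorem refl_eq_refl_rootVec {a : E} {m : Model} {c : ℝ} (hc : c ≠ 0)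
    (h : ∀ k, c * a k = root m k) : refl a = refl (rootVec m) := by
  rw [← refl_smul hc a]
  congr 1
  ext k
  simpa using h k

theorem commute_refl_rootVec_iff {m n : Model} (hmn : m ≠ n) :
    Commute (refl (rootVec m)) (refl (rootVec n)) ↔ rootDot m n = 0 := by
  constructor
  · intro h
    have := inner_eq_zero_of_commute h (rootVec_ne_zero n) (by
      rw [inner_rootVec, inner_rootVec, inner_rootVec]
      exact_mod_cast rootDot_sq_ne m n hmn)
    rw [inner_rootVec] at this
    exact_mod_cast this
  · intro h
    exact commute_of_inner_eq_zero (by rw [inner_rootVec, h]; simp)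

theorem refl_rootVec_injective : Function.Injective fun m : Model => refl (rootVec m) := by
  intro m n h
  by_contra hmn
  have h' : refl (rootVec m) = refl (rootVec n) := h
  have hc : Commute (refl (rootVec m)) (refl (rootVec n)) := by rw [h']
  have h0 := (commute_refl_rootVec_iff hmn).1 hc
  exact refl_ne_of_inner_eq_zero (by rw [inner_rootVec, h0]; simp) (rootVec_ne_zero n) h'

theorem root_short : ∀ m : Model, m.1 = true →
    (∃ i, ∀ k, root m k = if k = i then 2 else 0) ∨ ∀ k, root m k = 1 ∨ root m k = -1 := by
  decide +kernel

theorem root_long : ∀ m : Model, m.1 = false → ∃ i j, i ≠ j ∧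
    ((∀ k, root m k = (if k = i then 2 else 0) + (if k = j then 2 else 0)) ∨
      (∀ k, root m k = (if k = i then 2 else 0) - (if k = j then 2 else 0))) := by
  decide +kernel

theorem half_rootVec_mem_shortRoots {m : Model} (hm : m.1 = true) :
    (1 / 2 : ℝ) • rootVec m ∈ shortRoots := by
  rcases root_short m hm with ⟨i, h⟩ | h
  · refine Or.inl ⟨i, Or.inl ?_⟩
    ext k
    by_cases hk : k = i <;> simp [h, hk]
  · refine Or.inr fun k => ?_
    rcases h k with h | h
    · left; simp [h]
    · right; simp [h]

theorem half_rootVec_mem_longRoots {m : Model} (hm : m.1 = false) :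
    (1 / 2 : ℝ) • rootVec m ∈ longRoots := by
  obtain ⟨i, j, hij, h | h⟩ := root_long m hm
  · refine ⟨i, j, hij, Or.inl ?_⟩
    ext k
    by_cases hk : k = i <;> by_cases hk' : k = j <;> simp_all
  · refine ⟨i, j, hij, Or.inr (Or.inl ?_)⟩
    ext k
    by_cases hk : k = i <;> by_cases hk' : k = j <;> simp_all

theorem refl_half_rootVec (m : Model) : refl ((1 / 2 : ℝ) • rootVec m) = refl (rootVec m) :=
  refl_smul (by norm_num) _

theorem isShortReflection_of_refl {m : Model} (hm : m.1 = true) {g : weylGroup}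
    (hg : (g : E ≃ₗᵢ[ℝ] E) = refl (rootVec m)) : IsShortReflection g :=
  ⟨_, half_rootVec_mem_shortRoots hm, by rw [hg, refl_half_rootVec]⟩

theorem isLongReflection_of_refl {m : Model} (hm : m.1 = false) {g : weylGroup}
    (hg : (g : E ≃ₗᵢ[ℝ] E) = refl (rootVec m)) : IsLongReflection g :=
  ⟨_, half_rootVec_mem_longRoots hm, by rw [hg, refl_half_rootVec]⟩

theorem refl_rootVec_mem (m : Model) : refl (rootVec m) ∈ weylGroup := by
  refine Subgroup.subset_closure ⟨(1 / 2 : ℝ) • rootVec m, ?_, (refl_half_rootVec m).symm⟩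
  rcases h : m.1 with _ | _
  · exact Or.inr (half_rootVec_mem_longRoots h)
  · exact Or.inl (half_rootVec_mem_shortRoots h)

/-- The reflection of the Weyl group labelled by `m`. -/
def weylRefl (m : Model) : weylGroup := ⟨refl (rootVec m), refl_rootVec_mem m⟩

/-- The vertex of the Weyl graph labelled by `m`. -/
def vertex (m : Model) : reflections :=
  ⟨weylRefl m, by
    rcases h : m.1 with _ | _
    · exact Or.inr (isLongReflection_of_refl h rfl)
    · exact Or.inl (isShortReflection_of_refl h rfl)⟩

theorem vertex_injective : Function.Injective vertex := by
  intro m n h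
  exact refl_rootVec_injective (congrArg (fun g : reflections => ((g : weylGroup) : E ≃ₗᵢ[ℝ] E)) h)

theorem exists_root_unit : ∀ i : Fin 4, ∃ m : Model, m.1 = true ∧
    ∀ k, root m k = if k = i then 2 else 0 := by
  decide +kernel

theorem exists_root_spin : ∀ s : Fin 4 → Bool, ∃ m : Model, m.1 = true ∧
    ((∀ k, root m k = if s k then 1 else -1) ∨ (∀ k, root m k = if s k then -1 else 1)) := by
  decide +kernel

theorem exists_root_add : ∀ i j : Fin 4, i ≠ j → ∃ m : Model, m.1 = false ∧
    ∀ k, root m k = (if k = i then 2 else 0) + (if k = j then 2 else 0) := by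
  decide +kernel

theorem exists_root_sub : ∀ i j : Fin 4, i ≠ j → ∃ m : Model, m.1 = false ∧
    ((∀ k, root m k = (if k = i then 2 else 0) - (if k = j then 2 else 0)) ∨
      (∀ k, root m k = (if k = j then 2 else 0) - (if k = i then 2 else 0))) := by
  decide +kernel

theorem exists_refl_eq_of_short {a : E} (ha : a ∈ shortRoots) :
    ∃ m : Model, m.1 = true ∧ refl a = refl (rootVec m) := by
  classical
  rcases ha with ⟨i, rfl | rfl⟩ | ha
  · obtain ⟨m, hm, h⟩ := exists_root_unit i
    refine ⟨m, hm, refl_eq_refl_rootVec (c := 2) (by norm_num) fun k => ?_⟩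
    by_cases hk : k = i <;> simp [h, hk]
  · obtain ⟨m, hm, h⟩ := exists_root_unit i
    refine ⟨m, hm, refl_eq_refl_rootVec (c := -2) (by norm_num) fun k => ?_⟩
    by_cases hk : k = i <;> simp [h, hk]
  · obtain ⟨m, hm, h⟩ := exists_root_spin fun k => decide (a k = 1 / 2)
    have hn : ¬ ((-(1 / 2) : ℝ) = 1 / 2) := by norm_num
    rcases h with h | h
    · refine ⟨m, hm, refl_eq_refl_rootVec (c := 2) (by norm_num) fun k => ?_⟩
      rw [h]
      rcases ha k with hk | hk
      · simp [hk]
      · rw [hk]; simp only [hn]; norm_num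
    · refine ⟨m, hm, refl_eq_refl_rootVec (c := -2) (by norm_num) fun k => ?_⟩
      rw [h]
      rcases ha k with hk | hk
      · simp [hk]
      · rw [hk]; simp only [hn]; norm_num

theorem exists_refl_eq_of_long {a : E} (ha : a ∈ longRoots) :
    ∃ m : Model, m.1 = false ∧ refl a = refl (rootVec m) := by
  obtain ⟨i, j, hij, rfl | rfl | rfl⟩ := ha
  · obtain ⟨m, hm, h⟩ := exists_root_add i j hij
    refine ⟨m, hm, refl_eq_refl_rootVec (c := 2) (by norm_num) fun k => ?_⟩
    by_cases hk : k = i <;> by_cases hk' : k = j <;> simp_all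
  · obtain ⟨m, hm, h | h⟩ := exists_root_sub i j hij
    · refine ⟨m, hm, refl_eq_refl_rootVec (c := 2) (by norm_num) fun k => ?_⟩
      by_cases hk : k = i <;> by_cases hk' : k = j <;> simp_all
    · refine ⟨m, hm, refl_eq_refl_rootVec (c := -2) (by norm_num) fun k => ?_⟩
      by_cases hk : k = i <;> by_cases hk' : k = j <;> simp_all
  · obtain ⟨m, hm, h⟩ := exists_root_add i j hij
    refine ⟨m, hm, refl_eq_refl_rootVec (c := -2) (by norm_num) fun k => ?_⟩
    by_cases hk : k = i <;> by_cases hk' : k = j <;> simp_all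

theorem vertex_surjective : Function.Surjective vertex := by
  rintro ⟨g, ⟨a, ha, hg⟩ | ⟨a, ha, hg⟩⟩
  · obtain ⟨m, -, h⟩ := exists_refl_eq_of_short ha
    exact ⟨m, Subtype.ext (Subtype.ext (by rw [hg, h]; rfl))⟩
  · obtain ⟨m, -, h⟩ := exists_refl_eq_of_long ha
    exact ⟨m, Subtype.ext (Subtype.ext (by rw [hg, h]; rfl))⟩

/-- The labelling of the vertices of the Weyl graph. -/
def vertexEquiv : Model ≃ reflections :=
  Equiv.ofBijective vertex ⟨vertex_injective, vertex_surjective⟩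

@[simp] theorem vertexEquiv_apply (m : Model) : vertexEquiv m = vertex m := rfl

theorem isShort_vertex_iff (m : Model) : weylGraph.IsShort (vertex m) ↔ m.1 = true := by
  refine ⟨?_, fun h => isShortReflection_of_refl h rfl⟩
  rintro ⟨a, ha, h⟩
  obtain ⟨n, hn, h'⟩ := exists_refl_eq_of_short ha
  have : m = n := refl_rootVec_injective (h.trans h')
  rw [this, hn]

theorem adj_vertex_iff (m n : Model) : weylGraph.graph.Adj (vertex m) (vertex n) ↔
    modelAdj (fun _ _ => false) m n = true := by
  by_cases hmn : m = n
  · subst hmn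
    simp [modelAdj_self]
  · rw [adj_iff, ← rootDot_eq_zero_iff m n hmn, ← commute_refl_rootVec_iff hmn]
    exact ⟨fun h => h.2, fun h => ⟨fun h' => hmn (refl_rootVec_injective h'), h⟩⟩

theorem model_isIsomorphic_weylGraph :
    (model fun _ _ => false).IsIsomorphic weylGraph :=
  ⟨⟨vertexEquiv, fun {a b} => adj_vertex_iff a b⟩, isShort_vertex_iff⟩

/-- The labels of the short vertices of the standard pair. -/
def pairShort (i : Fin 4) : Model := ![(true, 0, false, false), (true, 0, false, true),
  (true, 0, true, false), (true, 0, true, true)] i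

/-- The labels of the long vertices of the standard pair. -/
def pairLong (i : Fin 4) : Model := ![(false, 0, false, false), (false, 0, false, true),
  (false, 0, true, false), (false, 0, true, true)] i

theorem standardPair_x (i : Fin 4) : standardPair.x i = vertex (pairShort i) := by
  refine Subtype.ext (Subtype.ext ?_)
  change refl (e i) = refl (rootVec (pairShort i))
  refine refl_eq_refl_rootVec (c := 2) (by norm_num) fun k => ?_
  fin_cases i <;> fin_cases k <;> simp [pairShort, root]

theorem standardPair_y (i : Fin 4) : standardPair.y i = vertex (pairLong i) := by
  refine Subtype.ext (Subtype.ext ?_)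
  change refl (longFrame i) = refl (rootVec (pairLong i))
  refine refl_eq_refl_rootVec (c := 2) (by norm_num) fun k => ?_
  fin_cases i <;> fin_cases k <;> simp [pairLong, root, longFrame]

-- The standard pair consists of the short plane 0 and the long plane 0, so twisting reverses the
-- matching between just these two planes, that is, flips the entry `c 0 0`.
set_option synthInstance.maxHeartbeats 400000 in
set_option synthInstance.maxSize 1000 in
theorem modelAdj_twist : ∀ u v : Model,
    (((modelAdj (fun _ _ => false) u v = true ∧
      ¬ ∃ i j, (u = pairShort i ∧ v = pairLong j) ∨ (v = pairShort i ∧ u = pairLong j)) ∨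
      (∃ i j : Fin 4, ¬ (i < 2 ↔ j < 2) ∧
        ((u = pairShort i ∧ v = pairLong j) ∨ (v = pairShort i ∧ u = pairLong j)))) ↔
      modelAdj (fun i j => i == 0 && j == 0) u v = true) := by
  decide +kernel

theorem model_isIsomorphic_twistedWeylGraph :
    (model fun i j => i == 0 && j == 0).IsIsomorphic twistedWeylGraph := by
  refine ⟨⟨vertexEquiv, fun {u v} => ?_⟩, isShort_vertex_iff⟩
  refine Iff.trans ?_ (modelAdj_twist u v)
  simp only [twistedWeylGraph, BichromaticGraph.twistedCopy, vertexEquiv_apply, standardPair_x,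
    standardPair_y, vertex_injective.eq_iff, adj_vertex_iff]

end F4

/-! ### Isomorphisms and automorphism groups of bichromatic graphs. -/

namespace BichromaticGraph

section Isomorphisms

variable {V W X : Type*} {Γ : BichromaticGraph V} {Δ : BichromaticGraph W} {Θ : BichromaticGraph X}

theorem IsIsomorphic.symm (h : Γ.IsIsomorphic Δ) : Δ.IsIsomorphic Γ := by
  obtain ⟨e, he⟩ := h
  exact ⟨e.symm, fun v => by rw [← he, RelIso.apply_symm_apply]⟩

theorem IsIsomorphic.trans (h : Γ.IsIsomorphic Δ) (h' : Δ.IsIsomorphic Θ) :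
    Γ.IsIsomorphic Θ := by
  obtain ⟨e, he⟩ := h
  obtain ⟨f, hf⟩ := h'
  exact ⟨e.trans f, fun v => (hf _).trans (he v)⟩

theorem IsIsomorphic.localGraph (e : Γ.graph ≃g Δ.graph)
    (he : ∀ v, Δ.IsShort (e v) ↔ Γ.IsShort v) (v : V) :
    (Γ.localGraph v).IsIsomorphic (Δ.localGraph (e v)) := by
  refine ⟨⟨⟨fun u => ⟨e u, e.map_adj_iff.2 u.2⟩, fun u => ⟨e.symm u, ?_⟩, fun u => ?_,
    fun u => ?_⟩, ?_⟩, fun u => he u⟩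
  · have h : Δ.graph.Adj (e v) u := u.2
    rw [← e.apply_symm_apply (u : W)] at h
    exact e.map_adj_iff.1 h
  · exact Subtype.ext (e.symm_apply_apply _)
  · exact Subtype.ext (e.apply_symm_apply _)
  · intro a b
    exact e.map_adj_iff

theorem LocallyLike.congr_right (h : Γ.LocallyLike Δ) (h' : Δ.IsIsomorphic Θ) :
    Γ.LocallyLike Θ := by
  obtain ⟨e, he⟩ := h'
  intro v x hvx
  have h1 := h v (e.symm x) (by rw [hvx, ← he, RelIso.apply_symm_apply])
  have h2 := IsIsomorphic.localGraph e he (e.symm x)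
  rw [RelIso.apply_symm_apply] at h2
  exact h1.trans h2

/-- Isomorphic bichromatic graphs have isomorphic automorphism groups. -/
theorem IsIsomorphic.aut_mulEquiv (h : Γ.IsIsomorphic Δ) : Nonempty (Γ.aut ≃* Δ.aut) := by
  obtain ⟨e, he⟩ := h
  have he' : ∀ w, Γ.IsShort (e.symm w) ↔ Δ.IsShort w := fun w => by
    rw [← he, RelIso.apply_symm_apply]
  exact ⟨{
    toFun := fun g => ⟨e.symm.trans (g.1.trans e), fun w =>
      (he _).trans ((g.2 _).trans (he' w))⟩
    invFun := fun g => ⟨e.trans (g.1.trans e.symm), fun w =>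
      (he' _).trans ((g.2 _).trans (he w))⟩
    left_inv := fun g => Subtype.ext (RelIso.ext fun v => by simp)
    right_inv := fun g => Subtype.ext (RelIso.ext fun v => by simp)
    map_mul' := fun g g' => Subtype.ext (RelIso.ext fun v => by simp) }⟩

/-- Complementing the adjacencies between vertices of different types does not affect the
automorphism group. -/
theorem aut_mulEquiv_of_compl {Γ Γ' : BichromaticGraph V}
    (hs : ∀ v, Γ.IsShort v ↔ Γ'.IsShort v)
    (h1 : ∀ u v, Γ.SameType u v → (Γ.graph.Adj u v ↔ Γ'.graph.Adj u v))
    (h2 : ∀ u v, ¬ Γ.SameType u v → (Γ.graph.Adj u v ↔ ¬ Γ'.graph.Adj u v)) :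
    Nonempty (Γ.aut ≃* Γ'.aut) := by
  have key : ∀ g : V ≃ V, (∀ v, Γ.IsShort (g v) ↔ Γ.IsShort v) → ∀ u v,
      ((Γ.graph.Adj (g u) (g v) ↔ Γ.graph.Adj u v) ↔
        (Γ'.graph.Adj (g u) (g v) ↔ Γ'.graph.Adj u v)) := by
    intro g hg u v
    have hst : Γ.SameType (g u) (g v) ↔ Γ.SameType u v := by
      unfold SameType
      rw [hg, hg]
    by_cases h : Γ.SameType u v
    · rw [h1 u v h, h1 _ _ (hst.2 h)]
    · rw [h2 u v h, h2 _ _ (fun h' => h (hst.1 h')), not_iff_not]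
  exact ⟨{
    toFun := fun g => ⟨⟨g.1.toEquiv, fun {u v} =>
      (key g.1.toEquiv g.2 u v).1 g.1.map_adj_iff⟩, fun v =>
        (hs _).symm.trans ((g.2 v).trans (hs v))⟩
    invFun := fun g => ⟨⟨g.1.toEquiv, fun {u v} =>
      (key g.1.toEquiv (fun v => (hs _).trans ((g.2 v).trans (hs v).symm)) u v).2
        g.1.map_adj_iff⟩, fun v => (hs _).trans ((g.2 v).trans (hs v).symm)⟩
    left_inv := fun g => rfl
    right_inv := fun g => rfl
    map_mul' := fun g g' => rfl }⟩

end Isomorphisms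

end BichromaticGraph

/-! ### Classification of the models by parity. -/

namespace F4

open BichromaticGraph

/-- Translation of the affine planes of the model. -/
def translate (r t : Fin 3 → Bool × Bool) : Model ≃ Model :=
  Function.Involutive.toPerm (fun u => match u with
    | (true, i, p, q) => (true, i, p ^^ (r i).1, q ^^ (r i).2)
    | (false, i, p, q) => (false, i, p ^^ (t i).1, q ^^ (t i).2)) (by
    rintro ⟨_ | _, i, p, q⟩ <;> simp)

theorem translate_short (r t : Fin 3 → Bool × Bool) (i : Fin 3) (p q : Bool) :
    translate r t (true, i, p, q) = (true, i, p ^^ (r i).1, q ^^ (r i).2) := rfl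

theorem translate_long (r t : Fin 3 → Bool × Bool) (i : Fin 3) (p q : Bool) :
    translate r t (false, i, p, q) = (false, i, p ^^ (t i).1, q ^^ (t i).2) := rfl

theorem form_xor (j : Fin 3) (a b a' b' : Bool) :
    form j (a ^^ a') (b ^^ b') = (form j a b ^^ form j a' b') := by
  fin_cases j <;> simp [form, Bool.xor_comm, Bool.xor_left_comm]

theorem xor_beq_xor : ∀ a b c : Bool, ((a ^^ c) == (b ^^ c)) = (a == b) := by decide

/-- The forms are additive, so translating the short planes by `r` and the long planes by `t` adds
to the matrix exactly the left-hand side of `h`, and leaves adjacency inside planes unchanged. -/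
theorem model_isIsomorphic_of_translate {c d : Fin 3 → Fin 3 → Bool} (r t : Fin 3 → Bool × Bool)
    (h : ∀ i j, (form j (r i).1 (r i).2 ^^ form i (t j).1 (t j).2) = (c i j ^^ d i j)) :
    (model c).IsIsomorphic (model d) := by
  have cross : ∀ i j p q p' q',
      modelAdj d (translate r t (true, i, p, q)) (translate r t (false, j, p', q')) =
        modelAdj c (true, i, p, q) (false, j, p', q') := by
    intro i j p q p' q'
    have h' := h i j
    simp only [translate_short, translate_long, modelAdj, form_xor]
    revert h'
    generalize form j p q = x1
    generalize form i p' q' = x2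
    generalize form j (r i).1 (r i).2 = x3
    generalize form i (t j).1 (t j).2 = x4
    generalize c i j = x5
    generalize d i j = x6
    revert x1 x2 x3 x4 x5 x6
    decide
  have key : ∀ u v, modelAdj d (translate r t u) (translate r t v) = modelAdj c u v := by
    rintro ⟨_ | _, i, p, q⟩ ⟨_ | _, j, p', q'⟩
    · simp only [translate_long, modelAdj]
      by_cases hij : i = j
      · subst hij; simp [xor_beq_xor]
      · simp [beq_eq_false_iff_ne.2 hij]
    · rw [modelAdj_comm, cross, modelAdj_comm]
    · exact cross _ _ _ _ _ _
    · simp only [translate_short, modelAdj]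
      by_cases hij : i = j
      · subst hij; simp [xor_beq_xor]
      · simp [beq_eq_false_iff_ne.2 hij]
  refine ⟨⟨translate r t, fun {u v} => ?_⟩, ?_⟩
  · change modelAdj d _ _ = true ↔ modelAdj c _ _ = true
    rw [key]
  · rintro ⟨_ | _, i, p, q⟩ <;> exact Iff.rfl

/-- The sum of the entries of a matrix over the field with two elements. -/
def parity (c : Fin 3 → Fin 3 → Bool) : Bool :=
  ((c 0 0 ^^ c 0 1 ^^ c 0 2) ^^ (c 1 0 ^^ c 1 1 ^^ c 1 2)) ^^ (c 2 0 ^^ c 2 1 ^^ c 2 2)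

theorem model_isIsomorphic_of_parity_eq {c d : Fin 3 → Fin 3 → Bool} (h : parity c = parity d) :
    (model c).IsIsomorphic (model d) := by
  refine model_isIsomorphic_of_translate
    -- Let `e = c + d`. The short translations produce columns 0 and 1 of `e`, and in column 2 the
    -- sum of these two. Translating the last long plane by the sums of rows 0 and 1 of `e` corrects
    -- column 2 in these rows; row 2 then comes out right because the total sum of `e` vanishes.
    (fun i => (c i 0 ^^ d i 0, c i 1 ^^ d i 1))
    (fun j => if j = 2 then ((c 0 0 ^^ c 0 1 ^^ c 0 2) ^^ (d 0 0 ^^ d 0 1 ^^ d 0 2),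
      (c 1 0 ^^ c 1 1 ^^ c 1 2) ^^ (d 1 0 ^^ d 1 1 ^^ d 1 2)) else (false, false)) ?_
  have key : ∀ x y z x' y' z' : Bool, ((x ^^ x') ^^ (y ^^ y') ^^
      ((x ^^ y ^^ z) ^^ (x' ^^ y' ^^ z'))) = (z ^^ z') := by decide
  have key' : ∀ r s r' s' x y z x' y' z' : Bool,
      ((r ^^ s) ^^ (x ^^ y ^^ z)) = ((r' ^^ s') ^^ (x' ^^ y' ^^ z')) →
      ((x ^^ x') ^^ (y ^^ y') ^^ ((r ^^ r') ^^ (s ^^ s'))) = (z ^^ z') := by decide +kernel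
  intro i j
  fin_cases j
  · fin_cases i <;> simp [form]
  · fin_cases i <;> simp [form]
  · fin_cases i
    · exact key _ _ _ _ _ _
    · exact key _ _ _ _ _ _
    · exact key' _ _ _ _ _ _ _ _ _ _ h

/-- The model is determined up to isomorphism by a constant matrix. -/
theorem model_isIsomorphic_const (c : Fin 3 → Fin 3 → Bool) :
    (model c).IsIsomorphic (model fun _ _ => parity c) :=
  model_isIsomorphic_of_parity_eq (by unfold parity; simp)

/-- Passing from the zero matrix to the all-ones matrix complements precisely the adjacencies
between the two types. -/
theorem aut_model_const_mulEquiv :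
    Nonempty ((model fun _ _ => true).aut ≃* (model fun _ _ => false).aut) := by
  refine aut_mulEquiv_of_compl (fun _ => Iff.rfl) ?_ ?_
  · rintro ⟨_ | _, i, p, q⟩ ⟨_ | _, j, p', q'⟩ h
    · exact Iff.rfl
    · simp [SameType, model] at h
    · simp [SameType, model] at h
    · exact Iff.rfl
  · rintro ⟨_ | _, i, p, q⟩ ⟨_ | _, j, p', q'⟩ h
    · simp [SameType, model] at h
    · simp [model, modelAdj]
    · simp [model, modelAdj]
    · simp [SameType, model] at h

theorem twistedWeylGraph_isIsomorphic_model :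
    twistedWeylGraph.IsIsomorphic (model fun _ _ => true) :=
  model_isIsomorphic_twistedWeylGraph.symm.trans (model_isIsomorphic_of_parity_eq (by decide))

end F4

/-! ### The automorphism group of the Weyl graph. -/

namespace F4

/-- Up to sign, the reflection through the `m`-th root maps the `n`-th root to the `k`-th one. -/
def ReflMaps (m n k : Model) : Prop :=
  (∀ l, rootDot m m * root n l - 2 * rootDot m n * root m l = rootDot m m * root k l) ∨
    (∀ l, rootDot m m * root n l - 2 * rootDot m n * root m l = -(rootDot m m * root k l))

instance (m n k : Model) : Decidable (ReflMaps m n k) := by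
  unfold ReflMaps
  infer_instance

theorem conj_refl (g : E ≃ₗᵢ[ℝ] E) (a : E) : g * refl a * g⁻¹ = refl (g a) := by
  apply LinearIsometryEquiv.ext
  intro v
  change g (refl a (g.symm v)) = refl (g a) v
  have h : ⟪a, g.symm v⟫_ℝ = ⟪g a, v⟫_ℝ := by
    rw [← g.inner_map_map, LinearIsometryEquiv.apply_symm_apply]
  rw [refl_apply, refl_apply, map_sub, map_smul, LinearIsometryEquiv.apply_symm_apply, h,
    g.inner_map_map]

theorem ReflMaps.refl_refl {m n k : Model} (h : ReflMaps m n k) :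
    refl (refl (rootVec m) (rootVec n)) = refl (rootVec k) := by
  have hm : (rootDot m m : ℝ) ≠ 0 := by exact_mod_cast rootDot_self_ne m
  have key : ∀ l, (refl (rootVec m) (rootVec n)) l =
      ((rootDot m m * root n l - 2 * rootDot m n * root m l : ℤ) : ℝ) / rootDot m m := by
    intro l
    rw [refl_apply, inner_rootVec, inner_rootVec]
    simp only [PiLp.sub_apply, PiLp.smul_apply, rootVec_apply, smul_eq_mul]
    push_cast
    field_simp
  rcases h with h | h
  · refine refl_eq_refl_rootVec (c := 1) one_ne_zero fun l => ?_
    rw [key, h]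
    push_cast
    field_simp
  · refine refl_eq_refl_rootVec (c := -1) (by norm_num) fun l => ?_
    rw [key, h]
    push_cast
    field_simp

theorem ReflMaps.conj {m n k : Model} (h : ReflMaps m n k) :
    weylRefl m * weylRefl n * (weylRefl m)⁻¹ = weylRefl k :=
  Subtype.ext ((conj_refl _ _).trans h.refl_refl)

theorem exists_reflMaps : ∀ m n : Model, ∃ k : Model, k.1 = n.1 ∧ ReflMaps m n k := by
  decide +kernel

theorem weylRefl_inv (m : Model) : (weylRefl m)⁻¹ = weylRefl m := by
  refine inv_eq_of_mul_eq_one_left (Subtype.ext ?_)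
  apply LinearIsometryEquiv.ext
  intro v
  change refl (rootVec m) (refl (rootVec m) v) = v
  unfold refl
  exact Submodule.reflection_reflection _ v

theorem closure_range_weylRefl : Subgroup.closure (Set.range weylRefl) = ⊤ := by
  have h : weylGroup = Subgroup.closure (weylGroup.subtype '' Set.range weylRefl) := by
    refine le_antisymm ?_ ?_
    · refine (Subgroup.closure_le _).2 ?_
      rintro g ⟨a, ha, rfl⟩
      refine Subgroup.subset_closure ?_
      rcases ha with ha | ha
      · obtain ⟨m, -, h⟩ := exists_refl_eq_of_short ha
        exact ⟨weylRefl m, ⟨m, rfl⟩, h.symm⟩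
      · obtain ⟨m, -, h⟩ := exists_refl_eq_of_long ha
        exact ⟨weylRefl m, ⟨m, rfl⟩, h.symm⟩
    · refine (Subgroup.closure_le _).2 ?_
      rintro _ ⟨g, -, rfl⟩
      exact g.2
  rw [← MonoidHom.map_closure] at h
  refine eq_top_iff.2 fun g _ => ?_
  have hg : (g : E ≃ₗᵢ[ℝ] E) ∈ (Subgroup.closure (Set.range weylRefl)).map weylGroup.subtype :=
    h ▸ g.2
  obtain ⟨g', hg', h'⟩ := hg
  rwa [← Subtype.ext h']

/-- A reflection permutes the roots up to sign and preserves their length, by a finite check. The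
property passes to products, so it holds on the group generated. -/
theorem exists_conj_eq (g : weylGroup) :
    ∀ n : Model, ∃ k : Model, k.1 = n.1 ∧ g * weylRefl n * g⁻¹ = weylRefl k := by
  have hg : g ∈ Subgroup.closure (Set.range weylRefl) := by
    rw [closure_range_weylRefl]; trivial
  have gen : ∀ m n : Model, ∃ k : Model, k.1 = n.1 ∧
      weylRefl m * weylRefl n * (weylRefl m)⁻¹ = weylRefl k := by
    intro m n
    obtain ⟨k, hk, h⟩ := exists_reflMaps m n
    exact ⟨k, hk, h.conj⟩
  induction hg using Subgroup.closure_induction'' with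
  | mem x hx =>
    obtain ⟨m, rfl⟩ := hx
    exact gen m
  | inv_mem x hx =>
    obtain ⟨m, rfl⟩ := hx
    rw [weylRefl_inv]
    exact gen m
  | one => exact fun n => ⟨n, rfl, by simp⟩
  | mul x y _ _ ihx ihy =>
    intro n
    obtain ⟨k, hk, h⟩ := ihy n
    obtain ⟨l, hl, h'⟩ := ihx k
    refine ⟨l, hl.trans hk, ?_⟩
    rw [← h', ← h]
    group

theorem isShortReflection_conj (g : weylGroup) {r : weylGroup} (hr : IsShortReflection r) :
    IsShortReflection (g * r * g⁻¹) := by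
  obtain ⟨a, ha, h⟩ := hr
  obtain ⟨n, hn, h'⟩ := exists_refl_eq_of_short ha
  obtain rfl : r = weylRefl n := Subtype.ext (h.trans h')
  obtain ⟨k, hk, h''⟩ := exists_conj_eq g n
  rw [h'']
  exact isShortReflection_of_refl (hk.trans hn) rfl

theorem isLongReflection_conj (g : weylGroup) {r : weylGroup} (hr : IsLongReflection r) :
    IsLongReflection (g * r * g⁻¹) := by
  obtain ⟨a, ha, h⟩ := hr
  obtain ⟨n, hn, h'⟩ := exists_refl_eq_of_long ha
  obtain rfl : r = weylRefl n := Subtype.ext (h.trans h')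
  obtain ⟨k, hk, h''⟩ := exists_conj_eq g n
  rw [h'']
  exact isLongReflection_of_refl (hk.trans hn) rfl

/-- Conjugation on the set of reflections. -/
def conjReflections (g : weylGroup) (r : reflections) : reflections :=
  ⟨g * r * g⁻¹, r.2.imp (isShortReflection_conj g) (isLongReflection_conj g)⟩

theorem conjReflections_mul (g h : weylGroup) (r : reflections) :
    conjReflections (g * h) r = conjReflections g (conjReflections h r) :=
  Subtype.ext (by simp only [conjReflections]; group)

theorem conjReflections_one (r : reflections) : conjReflections 1 r = r :=
  Subtype.ext (by simp [conjReflections])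

theorem isShort_conjReflections (g : weylGroup) (r : reflections) :
    weylGraph.IsShort (conjReflections g r) ↔ weylGraph.IsShort r := by
  refine ⟨fun h => ?_, isShortReflection_conj g⟩
  have h' : weylGraph.IsShort (conjReflections g⁻¹ (conjReflections g r)) :=
    isShortReflection_conj g⁻¹ h
  rwa [← conjReflections_mul, inv_mul_cancel, conjReflections_one] at h'

theorem adj_conjReflections (g : weylGroup) (r s : reflections) :
    weylGraph.graph.Adj (conjReflections g r) (conjReflections g s) ↔ weylGraph.graph.Adj r s := by
  have h : ∀ (g : weylGroup) (r s : reflections), weylGraph.graph.Adj r s →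
      weylGraph.graph.Adj (conjReflections g r) (conjReflections g s) := by
    rintro g r s ⟨h1, h2⟩
    refine ⟨fun h => h1 ?_, ?_⟩
    · rw [← conjReflections_one r, ← conjReflections_one s, ← inv_mul_cancel g,
        conjReflections_mul, conjReflections_mul, h]
    · exact h2.map (MulAut.conj g)
  refine ⟨fun h' => ?_, h g r s⟩
  have := h g⁻¹ _ _ h'
  rwa [← conjReflections_mul, ← conjReflections_mul, inv_mul_cancel, conjReflections_one,
    conjReflections_one] at this

/-- The action of the Weyl group on its Weyl graph by conjugation. -/
def conjAut : weylGroup →* weylGraph.aut where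
  toFun g := ⟨⟨⟨conjReflections g, conjReflections g⁻¹,
    fun r => by rw [← conjReflections_mul, inv_mul_cancel, conjReflections_one],
    fun r => by rw [← conjReflections_mul, mul_inv_cancel, conjReflections_one]⟩,
    fun {r s} => adj_conjReflections g r s⟩, isShort_conjReflections g⟩
  map_one' := Subtype.ext (RelIso.ext conjReflections_one)
  map_mul' g h := Subtype.ext (RelIso.ext (conjReflections_mul g h))

theorem conjAut_apply (g : weylGroup) (r : reflections) :
    (conjAut g).1 r = conjReflections g r := rfl

theorem conjAut_weylRefl_vertex {m n k : Model} (h : ReflMaps m n k) :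
    (conjAut (weylRefl m)).1 (vertex n) = vertex k :=
  Subtype.ext h.conj

/-- Acting trivially means commuting with every reflection, and the reflections generate the group.
-/
theorem ker_conjAut : conjAut.ker = Subgroup.center weylGroup := by
  ext g
  rw [MonoidHom.mem_ker, Subgroup.mem_center_iff]
  constructor
  · intro hg x
    have hx : x ∈ Subgroup.closure (Set.range weylRefl) := by
      rw [closure_range_weylRefl]; trivial
    have hle : Subgroup.closure (Set.range weylRefl) ≤ Subgroup.centralizer {g} := by
      refine (Subgroup.closure_le _).2 ?_
      rintro _ ⟨m, rfl⟩
      have h : conjReflections g (vertex m) = vertex m := by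
        rw [← conjAut_apply, hg]; rfl
      have h' : g * weylRefl m * g⁻¹ = weylRefl m := congrArg Subtype.val h
      exact Subgroup.mem_centralizer_singleton_iff.2 (mul_inv_eq_iff_eq_mul.1 h').symm
    exact Subgroup.mem_centralizer_singleton_iff.1 (hle hx)
  · intro hg
    refine Subtype.ext (RelIso.ext fun r => Subtype.ext ?_)
    change g * r * g⁻¹ = r
    rw [← hg, mul_inv_cancel_right]

/-- An automorphism of the Weyl graph fixes the vertex labelled by `m`. -/
def Fixes (φ : weylGraph.aut) (m : Model) : Prop := φ.1 (vertex m) = vertex m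

theorem exists_vertex_eq (φ : weylGraph.aut) (m : Model) : ∃ n : Model, n.1 = m.1 ∧
    φ.1 (vertex m) = vertex n ∧ ∀ k l, φ.1 (vertex k) = vertex l →
      modelAdj (fun _ _ => false) l n = modelAdj (fun _ _ => false) k m := by
  obtain ⟨n, hn⟩ := vertex_surjective (φ.1 (vertex m))
  refine ⟨n, ?_, hn.symm, fun k l hkl => ?_⟩
  · have := φ.2 (vertex m)
    rw [← hn, isShort_vertex_iff, isShort_vertex_iff] at this
    exact Bool.eq_iff_iff.2 this
  · have := φ.1.map_adj_iff (v := vertex k) (w := vertex m)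
    rw [← hn, hkl, adj_vertex_iff, adj_vertex_iff] at this
    exact Bool.eq_iff_iff.2 this

/-- The label `v` is determined by its type and its adjacencies to the labels in `F`. -/
def IsDetermined (F : Finset Model) (v : Model) : Prop :=
  ∀ w : Model, w.1 = v.1 →
    (∀ f ∈ F, modelAdj (fun _ _ => false) f w = modelAdj (fun _ _ => false) f v) → w = v

set_option synthInstance.maxHeartbeats 400000 in
set_option synthInstance.maxSize 1000 in
instance (F : Finset Model) (v : Model) : Decidable (IsDetermined F v) := by
  unfold IsDetermined
  infer_instance

/-- The labels that are determined by their type and their adjacencies to the labels in `F`. -/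
def determined (F : Finset Model) : Finset Model :=
  Finset.univ.filter fun v => IsDetermined F v

/-- The image of `v` has the same type as `v` and the same adjacencies to the fixed vertices, which
leaves only `v` itself. Iterating four times from `base` reaches all vertices. -/
theorem fixes_of_mem_determined {φ : weylGraph.aut} {F : Finset Model}
    (hF : ∀ f ∈ F, Fixes φ f) : ∀ v ∈ determined F, Fixes φ v := by
  intro v hv
  obtain ⟨n, hn, h, hadj⟩ := exists_vertex_eq φ v
  have := (Finset.mem_filter.1 hv).2 n hn fun f hf => hadj f f (hF f hf)
  rw [Fixes, h, this]

/-- Labels of four vertices of the Weyl graph that form a base of its automorphism group. -/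
def base : Fin 4 → Model :=
  ![(true, 0, false, false), (false, 0, false, false), (false, 1, false, false),
    (true, 2, false, true)]

theorem determined_base : ∀ v : Model, v ∈ determined (determined (determined
    (determined {base 0, base 1, base 2, base 3}))) := by
  decide +kernel

theorem eq_one_of_fixes_base {φ : weylGraph.aut} (h : ∀ i, Fixes φ (base i)) : φ = 1 := by
  have h0 : ∀ f ∈ ({base 0, base 1, base 2, base 3} : Finset Model), Fixes φ f := by
    intro f hf
    simp only [Finset.mem_insert, Finset.mem_singleton] at hf
    rcases hf with rfl | rfl | rfl | rfl <;> exact h _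
  have h1 := fixes_of_mem_determined (fixes_of_mem_determined (fixes_of_mem_determined
    (fixes_of_mem_determined h0)))
  refine Subtype.ext (RelIso.ext fun r => ?_)
  obtain ⟨m, rfl⟩ := vertex_surjective r
  exact h1 m (determined_base m)

/-- Start of the stabilizer chain: the possible images of the four base vertices, given that the
earlier ones are fixed, number 12, 6, 4 and 2, and reflections fixing the earlier ones move each of
them back. The product 576 is the order of the group modulo its center. -/
theorem exists_reflMaps_base_zero : ∀ m : Model, m.1 = true → ∃ n, ReflMaps n m (base 0) := by
  decide +kernel

theorem exists_reflMaps_base_one : ∀ m : Model, m.1 = false →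
    modelAdj (fun _ _ => false) (base 0) m = true →
    ∃ n, ReflMaps n m (base 1) ∧ ReflMaps n (base 0) (base 0) := by
  decide +kernel

theorem exists_reflMaps_base_two : ∀ m : Model, m.1 = false →
    modelAdj (fun _ _ => false) (base 0) m = true →
    modelAdj (fun _ _ => false) (base 1) m = false → m ≠ base 1 →
    ∃ n n' m', ReflMaps n m m' ∧ ReflMaps n' m' (base 2) ∧
      ReflMaps n (base 0) (base 0) ∧ ReflMaps n' (base 0) (base 0) ∧
      ReflMaps n (base 1) (base 1) ∧ ReflMaps n' (base 1) (base 1) := by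
  decide +kernel

set_option synthInstance.maxHeartbeats 400000 in
set_option synthInstance.maxSize 1000 in
theorem exists_reflMaps_base_three : ∀ m : Model, m.1 = true →
    modelAdj (fun _ _ => false) (base 0) m = false → m ≠ base 0 →
    modelAdj (fun _ _ => false) (base 1) m = true →
    modelAdj (fun _ _ => false) (base 2) m = false →
    -- Two labels remain: `base 3` itself and its image under the reflection through the first basis
    -- vector.
    m = base 3 ∨ ∃ n, ReflMaps n m (base 3) ∧ ReflMaps n (base 0) (base 0) ∧
      ReflMaps n (base 1) (base 1) ∧ ReflMaps n (base 2) (base 2) := by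
  decide +kernel

theorem apply_weylRefl_mul {φ : weylGraph.aut} {n a b c : Model}
    (h : φ.1 (vertex a) = vertex b) (hn : ReflMaps n b c) :
    (conjAut (weylRefl n) * φ).1 (vertex a) = vertex c := by
  change (conjAut (weylRefl n)).1 (φ.1 (vertex a)) = _
  rw [h, conjAut_weylRefl_vertex hn]

theorem mem_range_of_mul {φ : weylGraph.aut} {g : weylGroup}
    (h : conjAut g * φ ∈ conjAut.range) : φ ∈ conjAut.range :=
  (Subgroup.mul_mem_cancel_left conjAut.range (MonoidHom.mem_range.2 ⟨g, rfl⟩)).1 h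

theorem ne_of_vertex_eq {φ : weylGraph.aut} {a b c : Model} (ha : Fixes φ a)
    (h : φ.1 (vertex b) = vertex c) (hab : a ≠ b) : c ≠ a := by
  rintro rfl
  exact hab (vertex_injective (φ.1.injective (ha.trans h.symm)))

theorem mem_range_of_fixes_three (φ : weylGraph.aut) (h0 : Fixes φ (base 0))
    (h1 : Fixes φ (base 1)) (h2 : Fixes φ (base 2)) : φ ∈ conjAut.range := by
  obtain ⟨m, hm, h, hadj⟩ := exists_vertex_eq φ (base 3)
  rcases exists_reflMaps_base_three m hm (hadj _ _ h0) (ne_of_vertex_eq h0 h (by decide))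
    (hadj _ _ h1) (hadj _ _ h2) with rfl | ⟨n, hn3, hn0, hn1, hn2⟩
  · rw [eq_one_of_fixes_base (φ := φ)]
    · exact one_mem _
    · intro i
      fin_cases i
      · exact h0
      · exact h1
      · exact h2
      · exact h
  refine mem_range_of_mul (g := weylRefl n) ?_
  rw [eq_one_of_fixes_base (φ := conjAut (weylRefl n) * φ)]
  · exact one_mem _
  · intro i
    fin_cases i
    · exact apply_weylRefl_mul h0 hn0
    · exact apply_weylRefl_mul h1 hn1
    · exact apply_weylRefl_mul h2 hn2
    · exact apply_weylRefl_mul h hn3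

theorem mem_range_of_fixes_two (φ : weylGraph.aut) (h0 : Fixes φ (base 0))
    (h1 : Fixes φ (base 1)) : φ ∈ conjAut.range := by
  obtain ⟨m, hm, h, hadj⟩ := exists_vertex_eq φ (base 2)
  obtain ⟨n, n', m', hn2, hn2', hn0, hn0', hn1, hn1'⟩ := exists_reflMaps_base_two m hm
    (hadj _ _ h0) (hadj _ _ h1) (ne_of_vertex_eq h1 h (by decide))
  refine mem_range_of_mul (g := weylRefl n) (mem_range_of_mul (g := weylRefl n') ?_)
  exact mem_range_of_fixes_three _ (apply_weylRefl_mul (apply_weylRefl_mul h0 hn0) hn0')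
    (apply_weylRefl_mul (apply_weylRefl_mul h1 hn1) hn1')
    (apply_weylRefl_mul (apply_weylRefl_mul h hn2) hn2')

theorem conjAut_surjective : Function.Surjective conjAut := by
  rw [← MonoidHom.range_eq_top, eq_top_iff]
  intro φ _
  obtain ⟨m, hm, h, -⟩ := exists_vertex_eq φ (base 0)
  obtain ⟨n, hn⟩ := exists_reflMaps_base_zero m hm
  refine mem_range_of_mul (g := weylRefl n) ?_
  have h0 := apply_weylRefl_mul h hn
  obtain ⟨m', hm', h', hadj⟩ := exists_vertex_eq (conjAut (weylRefl n) * φ) (base 1)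
  obtain ⟨n', hn1, hn0⟩ := exists_reflMaps_base_one m' hm' (hadj _ _ h0)
  refine mem_range_of_mul (g := weylRefl n') ?_
  exact mem_range_of_fixes_two _ (apply_weylRefl_mul h0 hn0) (apply_weylRefl_mul h' hn1)

/-- The automorphism group of the Weyl graph is the Weyl group modulo its center. -/
theorem aut_weylGraph_mulEquiv :
    Nonempty (weylGraph.aut ≃* (weylGroup ⧸ Subgroup.center weylGroup)) :=
  ⟨((QuotientGroup.quotientMulEquivOfEq ker_conjAut.symm).trans
    (QuotientGroup.quotientKerEquivOfSurjective conjAut conjAut_surjective)).symm⟩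

end F4

/-! ### Local axioms, and their transfer from the Weyl graph. -/

namespace BichromaticGraph

section Local

variable {V : Type*} {Γ : BichromaticGraph V}

theorem SameType.refl (u : V) : Γ.SameType u u := Iff.rfl

theorem SameType.symm {u v : V} (h : Γ.SameType u v) : Γ.SameType v u := Iff.symm h

theorem SameType.trans {u v w : V} (h : Γ.SameType u v) (h' : Γ.SameType v w) : Γ.SameType u w :=
  Iff.trans h h'

theorem sameType_of_not {u v w : V} (h : ¬ Γ.SameType u v) (h' : ¬ Γ.SameType v w) :
    Γ.SameType u w := by
  unfold SameType at *
  tauto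

/-- The properties of the local graphs of the Weyl graph of type `F₄` that determine it: the
neighbors of a vertex `v` of its own type form a triangle, those of the other type form a matching,
and two adjacent vertices of the same type have exactly two, adjacent, common neighbors of the other
type. -/
structure IsLocallyF4 (Γ : BichromaticGraph V) : Prop where
  clique : ∀ {v a b}, Γ.graph.Adj v a → Γ.graph.Adj v b → Γ.SameType v a → Γ.SameType v b →
    a ≠ b → Γ.graph.Adj a b
  triangle : ∀ v, ∃ q : Fin 3 → V, Function.Injective q ∧
    ∀ z, (Γ.graph.Adj v z ∧ Γ.SameType v z) ↔ ∃ k, q k = z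
  matching : ∀ {v a}, Γ.graph.Adj v a → ¬ Γ.SameType v a →
    ∃ b, Γ.graph.Adj v b ∧ Γ.SameType a b ∧ Γ.graph.Adj a b ∧
      ∀ z, Γ.graph.Adj v z → Γ.SameType a z → Γ.graph.Adj a z → z = b
  line : ∀ {v a}, Γ.graph.Adj v a → Γ.SameType v a →
    ∃ b c, Γ.graph.Adj v b ∧ Γ.graph.Adj v c ∧ Γ.graph.Adj a b ∧ Γ.graph.Adj a c ∧
      ¬ Γ.SameType v b ∧ ¬ Γ.SameType v c ∧ Γ.graph.Adj b c ∧
      ∀ z, Γ.graph.Adj v z → Γ.graph.Adj a z → ¬ Γ.SameType v z → z = b ∨ z = c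

end Local

end BichromaticGraph

namespace F4

open BichromaticGraph

set_option synthInstance.maxHeartbeats 400000 in
set_option synthInstance.maxSize 1000 in
theorem model_clique : ∀ m a b : Model, modelAdj (fun _ _ => false) m a = true →
    modelAdj (fun _ _ => false) m b = true → m.1 = a.1 → m.1 = b.1 → a ≠ b →
    modelAdj (fun _ _ => false) a b = true := by
  decide +kernel

/-- The neighbors of its own type of a vertex of the model. -/
def modelTriangle (m : Model) : Fin 3 → Model :=
  ![(m.1, m.2.1, m.2.2.1, !m.2.2.2), (m.1, m.2.1, !m.2.2.1, m.2.2.2),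
    (m.1, m.2.1, !m.2.2.1, !m.2.2.2)]

theorem modelTriangle_injective : ∀ m, ∀ k l, modelTriangle m k = modelTriangle m l → k = l := by
  decide +kernel

theorem exists_modelTriangle_eq_iff : ∀ m z : Model,
    (modelAdj (fun _ _ => false) m z = true ∧ m.1 = z.1) ↔ ∃ k, modelTriangle m k = z := by
  decide +kernel

set_option synthInstance.maxHeartbeats 400000 in
set_option synthInstance.maxSize 1000 in
theorem model_matching : ∀ m a : Model, modelAdj (fun _ _ => false) m a = true → m.1 ≠ a.1 →
    ∃ b : Model, modelAdj (fun _ _ => false) m b = true ∧ a.1 = b.1 ∧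
      modelAdj (fun _ _ => false) a b = true ∧
      ∀ z : Model, modelAdj (fun _ _ => false) m z = true → a.1 = z.1 →
        modelAdj (fun _ _ => false) a z = true → z = b := by
  decide +kernel

set_option synthInstance.maxHeartbeats 400000 in
set_option synthInstance.maxSize 1000 in
theorem model_line : ∀ m a : Model, modelAdj (fun _ _ => false) m a = true → m.1 = a.1 →
    ∃ b c : Model, modelAdj (fun _ _ => false) m b = true ∧
      modelAdj (fun _ _ => false) m c = true ∧
      modelAdj (fun _ _ => false) a b = true ∧ modelAdj (fun _ _ => false) a c = true ∧
      m.1 ≠ b.1 ∧ m.1 ≠ c.1 ∧ modelAdj (fun _ _ => false) b c = true ∧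
      ∀ z : Model, modelAdj (fun _ _ => false) m z = true →
        modelAdj (fun _ _ => false) a z = true → m.1 ≠ z.1 → z = b ∨ z = c := by
  decide +kernel

/-- A local isomorphism with the model, extended to a map on all vertices. -/
theorem exists_local_maps {V : Type*} {Γ : BichromaticGraph V}
    (h : Γ.LocallyLike (model fun _ _ => false)) (v : V) :
    ∃ (m : Model) (f : V → Model) (g : Model → V),
      (∀ a, Γ.graph.Adj v a → modelAdj (fun _ _ => false) m (f a) = true) ∧
      (∀ n, modelAdj (fun _ _ => false) m n = true → Γ.graph.Adj v (g n)) ∧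
      (∀ a, Γ.graph.Adj v a → g (f a) = a) ∧
      (∀ n, modelAdj (fun _ _ => false) m n = true → f (g n) = n) ∧
      (∀ a b, Γ.graph.Adj v a → Γ.graph.Adj v b →
        (modelAdj (fun _ _ => false) (f a) (f b) = true ↔ Γ.graph.Adj a b)) ∧
      (∀ a, Γ.graph.Adj v a → (Γ.SameType v a ↔ m.1 = (f a).1)) ∧
      (∀ a b, Γ.graph.Adj v a → Γ.graph.Adj v b →
        (Γ.SameType a b ↔ (f a).1 = (f b).1)) := by
  classical
  obtain ⟨m, hm⟩ : ∃ m : Model, m.1 = true ↔ Γ.IsShort v :=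
    ⟨(decide (Γ.IsShort v), 0, false, false), by simp⟩
  obtain ⟨e, he⟩ := h v m hm.symm
  have hf : ∀ a (ha : Γ.graph.Adj v a),
      (if h : Γ.graph.Adj v a then ((e ⟨a, h⟩ : (model _).graph.neighborSet m) : Model) else m) =
        e ⟨a, ha⟩ := fun a ha => dif_pos ha
  have hg : ∀ n (hn : modelAdj (fun _ _ => false) m n = true),
      (if h : modelAdj (fun _ _ => false) m n = true then
        ((e.symm ⟨n, h⟩ : Γ.graph.neighborSet v) : V) else v) = e.symm ⟨n, hn⟩ :=
    fun n hn => dif_pos hn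
  have hs : ∀ a (ha : Γ.graph.Adj v a), ((e ⟨a, ha⟩ : Model).1 = true ↔ Γ.IsShort a) :=
    fun a ha => he ⟨a, ha⟩
  -- The values off the neighbor sets are arbitrary; total maps avoid carrying membership proofs.
  refine ⟨m, fun a => if h : Γ.graph.Adj v a then (e ⟨a, h⟩ : Model) else m,
    fun n => if h : modelAdj (fun _ _ => false) m n = true then (e.symm ⟨n, h⟩ : V) else v,
    ?_, ?_, ?_, ?_, ?_, ?_, ?_⟩
  · intro a ha
    simp only [hf a ha]
    exact (e ⟨a, ha⟩).2
  · intro n hn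
    simp only [hg n hn]
    exact (e.symm ⟨n, hn⟩).2
  · intro a ha
    have h1 : modelAdj (fun _ _ => false) m (e ⟨a, ha⟩ : Model) = true := (e ⟨a, ha⟩).2
    simp only [hf a ha, hg _ h1]
    exact congrArg Subtype.val (e.symm_apply_apply ⟨a, ha⟩)
  · intro n hn
    have h1 : Γ.graph.Adj v (e.symm ⟨n, hn⟩ : V) := (e.symm ⟨n, hn⟩).2
    simp only [hg n hn, hf _ h1]
    exact congrArg Subtype.val (e.apply_symm_apply ⟨n, hn⟩)
  · intro a b ha hb
    simp only [hf a ha, hf b hb]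
    exact e.map_adj_iff (v := ⟨a, ha⟩) (w := ⟨b, hb⟩)
  · intro a ha
    simp only [hf a ha]
    exact (iff_congr hm (hs a ha)).symm.trans Bool.eq_iff_iff.symm
  · intro a b ha hb
    simp only [hf a ha, hf b hb]
    exact (iff_congr (hs a ha) (hs b hb)).symm.trans Bool.eq_iff_iff.symm

theorem isLocallyF4_of_locallyLike {V : Type*} {Γ : BichromaticGraph V}
    (h : Γ.LocallyLike weylGraph) : Γ.IsLocallyF4 := by
  have h' := h.congr_right model_isIsomorphic_weylGraph.symm
  constructor
  · intro v a b ha hb hva hvb hab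
    obtain ⟨m, f, g, hf, hg, hgf, hfg, hadj, hs, hss⟩ := exists_local_maps h' v
    refine (hadj a b ha hb).1 (model_clique m _ _ (hf a ha) (hf b hb) ((hs a ha).1 hva)
      ((hs b hb).1 hvb) fun hab' => hab ?_)
    rw [← hgf a ha, ← hgf b hb, hab']
  · intro v
    obtain ⟨m, f, g, hf, hg, hgf, hfg, hadj, hs, hss⟩ := exists_local_maps h' v
    have hq := fun k => (exists_modelTriangle_eq_iff m _).2 ⟨k, rfl⟩
    refine ⟨fun k => g (modelTriangle m k), fun k l hkl => ?_, fun z => ⟨?_, ?_⟩⟩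
    · have hkl' := congrArg f hkl
      simp only [hfg _ (hq _).1] at hkl'
      exact modelTriangle_injective m k l hkl'
    · rintro ⟨hz, hvz⟩
      obtain ⟨k, hk⟩ := (exists_modelTriangle_eq_iff m _).1 ⟨hf z hz, (hs z hz).1 hvz⟩
      exact ⟨k, (congrArg g hk).trans (hgf z hz)⟩
    · rintro ⟨k, rfl⟩
      refine ⟨hg _ (hq k).1, (hs _ (hg _ (hq k).1)).2 ?_⟩
      rw [hfg _ (hq k).1]
      exact (hq k).2
  · intro v a ha hva
    obtain ⟨m, f, g, hf, hg, hgf, hfg, hadj, hs, hss⟩ := exists_local_maps h' v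
    obtain ⟨b, hb, hab, hab', huniq⟩ := model_matching m _ (hf a ha)
      (fun h => hva ((hs a ha).2 h))
    refine ⟨g b, hg b hb, (hss _ _ ha (hg b hb)).2 (by rwa [hfg b hb]),
      (hadj _ _ ha (hg b hb)).1 (by rwa [hfg b hb]), fun z hz haz haz' => ?_⟩
    rw [← huniq (f z) (hf z hz) ((hss _ _ ha hz).1 haz) ((hadj _ _ ha hz).2 haz'), hgf z hz]
  · intro v a ha hva
    obtain ⟨m, f, g, hf, hg, hgf, hfg, hadj, hs, hss⟩ := exists_local_maps h' v
    obtain ⟨b, c, hb, hc, hab, hac, hmb, hmc, hbc, huniq⟩ := model_line m _ (hf a ha)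
      ((hs a ha).1 hva)
    refine ⟨g b, g c, hg b hb, hg c hc, (hadj _ _ ha (hg b hb)).1 (by rwa [hfg b hb]),
      (hadj _ _ ha (hg c hc)).1 (by rwa [hfg c hc]),
      fun h => hmb (by rw [(hs _ (hg b hb)).1 h, hfg b hb]),
      fun h => hmc (by rw [(hs _ (hg c hc)).1 h, hfg c hc]),
      (hadj _ _ (hg b hb) (hg c hc)).1 (by rwa [hfg b hb, hfg c hc]), fun z hz haz hvz => ?_⟩
    rcases huniq (f z) (hf z hz) ((hadj _ _ ha hz).2 haz) (fun h => hvz ((hs z hz).2 h)) with h | h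
    · left; rw [← h, hgf z hz]
    · right; rw [← h, hgf z hz]

end F4

/-! ### Classes of vertices, and conditions implying tightness. -/

namespace BichromaticGraph

variable {V : Type*} {Γ : BichromaticGraph V}

/-- Two vertices are equal, or adjacent and of the same type. -/
def Rel (Γ : BichromaticGraph V) (u v : V) : Prop :=
  u = v ∨ (Γ.graph.Adj u v ∧ Γ.SameType u v)

theorem Rel.refl (u : V) : Γ.Rel u u := Or.inl rfl

theorem Rel.sameType {u v : V} (h : Γ.Rel u v) : Γ.SameType u v := by
  rcases h with rfl | h
  · exact Iff.rfl
  · exact h.2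

theorem Rel.symm {u v : V} (h : Γ.Rel u v) : Γ.Rel v u := by
  rcases h with rfl | h
  · exact Or.inl rfl
  · exact Or.inr ⟨h.1.symm, h.2.symm⟩

theorem Rel.adj {u v : V} (h : Γ.Rel u v) (huv : u ≠ v) : Γ.graph.Adj u v :=
  (h.resolve_left huv).1

theorem Rel.not_sameType {u v w : V} (h : Γ.Rel v w) (h' : ¬ Γ.SameType u v) :
    ¬ Γ.SameType u w := fun h'' => h' (h''.trans h.sameType.symm)

theorem rel_of_adj {u v : V} (h : Γ.graph.Adj u v) (h' : Γ.SameType u v) :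
    Γ.Rel u v := Or.inr ⟨h, h'⟩

/-- The vertex `v` has a neighbor in the class of `z`. -/
def Near (Γ : BichromaticGraph V) (v z : V) : Prop := ∃ y, Γ.Rel z y ∧ Γ.graph.Adj v y

/-- Every vertex has a neighbor in the class of every vertex of the other type. -/
def Tight (Γ : BichromaticGraph V) : Prop := ∀ v z, ¬ Γ.SameType v z → Γ.Near v z

namespace IsLocallyF4

variable (h : Γ.IsLocallyF4)

include h

/-- The neighbors of `v` of its own type form a clique. -/
theorem rel_trans {u v w : V} (huv : Γ.Rel u v) (hvw : Γ.Rel v w) : Γ.Rel u w := by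
  rcases huv with rfl | huv
  · exact hvw
  rcases hvw with rfl | hvw
  · exact Or.inr huv
  by_cases huw : u = w
  · exact Or.inl huw
  · exact Or.inr ⟨h.clique huv.1.symm hvw.1 huv.2.symm hvw.2 huw, huv.2.trans hvw.2⟩

theorem exists_class (v : V) : ∃ q : Fin 4 → V, Function.Injective q ∧
    ∀ z, Γ.Rel v z ↔ ∃ k, q k = z := by
  obtain ⟨q, hq, hz⟩ := h.triangle v
  refine ⟨Fin.cons v q, ?_, fun z => ?_⟩
  · refine Fin.cons_injective_iff.2 ⟨?_, hq⟩
    rintro ⟨k, hk⟩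
    exact ((hz v).2 ⟨k, hk⟩).1.ne rfl
  · rw [Fin.exists_fin_succ]
    simp only [Fin.cons_zero, Fin.cons_succ, ← hz]
    exact Iff.rfl

theorem eq_or_of_rel {v a b c d z : V} (ha : Γ.Rel v a) (hb : Γ.Rel v b) (hc : Γ.Rel v c)
    (hd : Γ.Rel v d) (hz : Γ.Rel v z) (hab : a ≠ b) (hac : a ≠ c) (had : a ≠ d) (hbc : b ≠ c)
    (hbd : b ≠ d) (hcd : c ≠ d) : z = a ∨ z = b ∨ z = c ∨ z = d := by
  obtain ⟨q, hq, hrel⟩ := h.exists_class v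
  obtain ⟨i, rfl⟩ := (hrel a).1 ha
  obtain ⟨j, rfl⟩ := (hrel b).1 hb
  obtain ⟨k, rfl⟩ := (hrel c).1 hc
  obtain ⟨l, rfl⟩ := (hrel d).1 hd
  obtain ⟨m, rfl⟩ := (hrel z).1 hz
  simp only [hq.eq_iff, ne_eq] at *
  omega

theorem exists_rel_ne_ne (v a b : V) : ∃ z, Γ.Rel v z ∧ z ≠ a ∧ z ≠ b := by
  obtain ⟨q, hq, hrel⟩ := h.exists_class v
  have key : q 0 ≠ q 1 ∧ q 0 ≠ q 2 ∧ q 1 ≠ q 2 := by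
    simp only [ne_eq, hq.eq_iff]
    decide
  by_cases h0 : q 0 ≠ a ∧ q 0 ≠ b
  · exact ⟨q 0, (hrel _).2 ⟨0, rfl⟩, h0⟩
  by_cases h1 : q 1 ≠ a ∧ q 1 ≠ b
  · exact ⟨q 1, (hrel _).2 ⟨1, rfl⟩, h1⟩
  refine ⟨q 2, (hrel _).2 ⟨2, rfl⟩, ?_⟩
  grind

theorem exists_partner {v a : V} (hva : Γ.graph.Adj v a) (ht : ¬ Γ.SameType v a) :
    ∃ b, b ≠ a ∧ Γ.Rel a b ∧ Γ.graph.Adj v b := by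
  obtain ⟨b, hb, hab, hadj, -⟩ := h.matching hva ht
  exact ⟨b, hadj.ne', rel_of_adj hadj hab, hb⟩

theorem partner_unique {v a b c : V} (ht : ¬ Γ.SameType v a) (hva : Γ.graph.Adj v a)
    (hvb : Γ.graph.Adj v b) (hvc : Γ.graph.Adj v c) (hab : Γ.Rel a b) (hac : Γ.Rel a c)
    (hb : b ≠ a) (hc : c ≠ a) : b = c := by
  obtain ⟨d, -, -, -, huniq⟩ := h.matching hva ht
  rw [huniq b hvb hab.sameType (hab.adj hb.symm), huniq c hvc hac.sameType (hac.adj hc.symm)]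

theorem exists_common {v w : V} (hvw : Γ.Rel v w) (hne : v ≠ w) :
    ∃ b, Γ.graph.Adj v b ∧ Γ.graph.Adj w b ∧ ¬ Γ.SameType v b := by
  obtain ⟨b, c, h1, h2, h3, h4, h5, -⟩ := h.line (hvw.adj hne) hvw.sameType
  exact ⟨b, h1, h3, h5⟩

theorem rel_of_common {v w a b : V} (hvw : Γ.Rel v w) (hne : v ≠ w) (hva : Γ.graph.Adj v a)
    (hwa : Γ.graph.Adj w a) (hvb : Γ.graph.Adj v b) (hwb : Γ.graph.Adj w b)
    (hta : ¬ Γ.SameType v a) (htb : ¬ Γ.SameType v b) : Γ.Rel a b := by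
  obtain ⟨c, d, -, -, -, -, hc, hd, hcd, huniq⟩ := h.line (hvw.adj hne) hvw.sameType
  have hr : Γ.Rel c d := rel_of_adj hcd (sameType_of_not (fun h' => hc h'.symm) hd)
  rcases huniq a hva hwa hta with rfl | rfl <;> rcases huniq b hvb hwb htb with rfl | rfl
  · exact Rel.refl _
  · exact hr
  · exact hr.symm
  · exact Rel.refl _

/-- The common opposite neighbors of `v ≠ w` form an adjacent pair. It contains `a`, so by
uniqueness of partners it contains every neighbor of `v` in the class of `a`. Thus one common
neighbor in a class forces equal neighborhoods there. -/
theorem adj_of_common {v w a b : V} (hvw : Γ.Rel v w) (hva : Γ.graph.Adj v a)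
    (hwa : Γ.graph.Adj w a) (hvb : Γ.graph.Adj v b) (hab : Γ.Rel a b)
    (hta : ¬ Γ.SameType v a) : Γ.graph.Adj w b := by
  by_cases hne : v = w
  · exact hne ▸ hvb
  by_cases hba : b = a
  · exact hba ▸ hwa
  obtain ⟨c, d, hvc, hvd, hwc, hwd, hc, hd, hcd, huniq⟩ := h.line (hvw.adj hne) hvw.sameType
  have hr : Γ.Rel c d := rel_of_adj hcd (sameType_of_not (fun h' => hc h'.symm) hd)
  rcases huniq a hva hwa hta with rfl | rfl
  · rwa [h.partner_unique hta hva hvb hvd hab hr hba hcd.ne']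
  · rwa [h.partner_unique hta hva hvb hvc hab hr.symm hba hcd.ne]

/-- Take `l k` to be a common neighbor of `v` and the `k`-th other vertex of its class. Conversely
an opposite neighbor `z` of `v` sees a partner of `v` in this class, which identifies `k`. -/
theorem exists_three (v : V) : ∃ l : Fin 3 → V, (∀ k, Γ.graph.Adj v (l k)) ∧
    (∀ k, ¬ Γ.SameType v (l k)) ∧ (∀ j k, Γ.Rel (l j) (l k) → j = k) ∧
    ∀ z, Γ.graph.Adj v z → ¬ Γ.SameType v z → ∃ k, Γ.Rel (l k) z := by
  obtain ⟨q, hq, hz⟩ := h.triangle v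
  have hqk := fun k => (hz _).2 ⟨k, rfl⟩
  have hrel : ∀ k, Γ.Rel v (q k) := fun k => Or.inr (hqk k)
  choose l hvl hql hl using fun k => h.exists_common (hrel k) (hqk k).1.ne
  refine ⟨l, hvl, hl, fun j k hjk => hq ?_, fun z hvz htz => ?_⟩
  · have h1 := h.adj_of_common (hrel j) (hvl j) (hql j) (hvl k) hjk (hl j)
    exact h.partner_unique (fun h' => hl k h'.symm) (hvl k).symm h1.symm (hql k).symm (hrel j)
      (hrel k) (hqk j).1.ne' (hqk k).1.ne'
  · obtain ⟨x, hx, hvx, hzx⟩ := h.exists_partner hvz.symm (fun h' => htz h'.symm)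
    obtain ⟨k, rfl⟩ := (hz x).1 ⟨hvx.adj hx.symm, hvx.sameType⟩
    exact ⟨k, h.rel_of_common hvx hx.symm (hvl k) (hql k) hvz hzx.symm (hl k) htz⟩

theorem exists_opposite (v : V) : ∃ w, ¬ Γ.SameType v w := by
  obtain ⟨l, -, hl, -⟩ := h.exists_three v
  exact ⟨l 0, hl 0⟩

/-- By transitivity of `Rel`, a connected component of one type lies in a single class. -/
theorem tight_of_tightlyConnected (ht : Γ.TightlyConnected) : Γ.Tight := by
  have key : ∀ (S : Set V), (∀ a ∈ S, ∀ b ∈ S, Γ.SameType a b) → ∀ a b : S,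
      (Γ.graph.induce S).Reachable a b → Γ.Rel (a : V) b := by
    intro S hS a b hab
    rw [SimpleGraph.reachable_iff_reflTransGen] at hab
    induction hab with
    | refl => exact Rel.refl _
    | tail _ hbc ih => exact h.rel_trans ih (rel_of_adj hbc (hS _ (Subtype.prop _) _
        (Subtype.prop _)))
  intro v z hvz
  by_cases hv : Γ.IsShort v
  · have hz : Γ.IsLong z := fun hz => hvz (iff_of_true hv hz)
    obtain ⟨w, hw, hvw⟩ := ht.2 v hv
      ((Γ.graph.induce {w | Γ.IsLong w}).connectedComponentMk ⟨z, hz⟩)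
    exact ⟨w, (key _ (fun a ha b hb => iff_of_false ha hb) _ _
      (SimpleGraph.ConnectedComponent.eq.1 hw)).symm, hvw⟩
  · have hz : Γ.IsShort z := by
      by_contra hz
      exact hvz (iff_of_false hv hz)
    obtain ⟨w, hw, hvw⟩ := ht.1 v hv
      ((Γ.graph.induce {w | Γ.IsShort w}).connectedComponentMk ⟨z, hz⟩)
    exact ⟨w, (key _ (fun a ha b hb => iff_of_true ha hb) _ _
      (SimpleGraph.ConnectedComponent.eq.1 hw)).symm, hvw⟩

theorem exists_twelve (v : V) : ∃ f : Fin 3 × Fin 4 → V, Function.Injective f ∧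
    ∀ k, ¬ Γ.SameType v (f k) ∧ Γ.Near v (f k) := by
  obtain ⟨l, hvl, hl, hll, -⟩ := h.exists_three v
  choose q hq hrel using h.exists_class
  have hqr : ∀ x k, Γ.Rel x (q x k) := fun x k => (hrel x _).2 ⟨k, rfl⟩
  refine ⟨fun k => q (l k.1) k.2, ?_, fun k => ⟨(hqr _ _).not_sameType (hl k.1), l k.1,
    (hqr _ _).symm, hvl k.1⟩⟩
  rintro ⟨i, k⟩ ⟨j, m⟩ hij
  have hij' : q (l i) k = q (l j) m := hij
  have : i = j := hll i j (h.rel_trans (hqr (l i) k) (hij' ▸ (hqr (l j) m).symm))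
  subst this
  rw [hq _ hij']

/-- A vertex reaches three opposite classes, hence there are at least 12 vertices of each type. A
class missed by some vertex would exceed the total of 24. -/
theorem tight_of_card (hV : Nat.card V = 24) : Γ.Tight := by
  classical
  have : Finite V := Nat.finite_of_card_ne_zero (by rw [hV]; norm_num)
  cases nonempty_fintype V
  rw [Nat.card_eq_fintype_card] at hV
  have key : ∀ v, 12 ≤ (Finset.univ.filter fun z => ¬ Γ.SameType v z ∧ Γ.Near v z).card := by
    intro v
    obtain ⟨f, hf, hfv⟩ := h.exists_twelve v
    have : (Finset.univ.map ⟨f, hf⟩).card = 12 := by simp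
    rw [← this]
    refine Finset.card_le_card fun z hz => ?_
    obtain ⟨k, -, rfl⟩ := Finset.mem_map.1 hz
    exact Finset.mem_filter.2 ⟨Finset.mem_univ _, hfv k⟩
  intro v z hvz
  by_contra hn
  -- The vertices opposite to `w` have the type of `v`, which bounds the number of the latter.
  obtain ⟨w, hw⟩ := h.exists_opposite v
  have h1 : 12 ≤ (Finset.univ.filter fun z => Γ.SameType v z).card :=
    (key w).trans (Finset.card_le_card fun x hx => Finset.mem_filter.2 ⟨Finset.mem_univ _,
      sameType_of_not hw (Finset.mem_filter.1 hx).2.1⟩)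
  have h2 : 12 < (Finset.univ.filter fun z => ¬ Γ.SameType v z).card :=
    (key v).trans_lt (Finset.card_lt_card (Finset.ssubset_iff_of_subset
      (fun x hx => Finset.mem_filter.2 ⟨Finset.mem_univ _, (Finset.mem_filter.1 hx).2.1⟩) |>.2
      ⟨z, Finset.mem_filter.2 ⟨Finset.mem_univ _, hvz⟩,
        fun hz => hn (Finset.mem_filter.1 hz).2.2⟩))
  have h3 := Finset.card_filter_add_card_filter_not (s := (Finset.univ : Finset V))
    (fun z => Γ.SameType v z)
  rw [Finset.card_univ, hV] at h3
  omega

/-- If `x` misses the class of `z`, each vertex of that class is reached in two steps, necessarily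
through one of the three other vertices in the class of `x`. Neighbors come in pairs: two of the
three serve `z` and its partner only, so a third vertex `z₃` is left with a single possible
neighbor, but needs two. -/
theorem tight_of_ediam (hd : Γ.graph.ediam = 2) : Γ.Tight := by
  have hdist : ∀ u v, u = v ∨ Γ.graph.Adj u v ∨ ∃ w, Γ.graph.Adj u w ∧ Γ.graph.Adj w v := by
    intro u v
    have hle : Γ.graph.edist u v ≤ 2 := hd ▸ SimpleGraph.edist_le_ediam
    obtain ⟨p, hp⟩ := SimpleGraph.exists_walk_of_edist_ne_top
      (ne_top_of_le_ne_top (by decide) hle)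
    rw [← hp] at hle
    have hle' : p.length ≤ 2 := by exact_mod_cast hle
    match p, hle' with
    | .nil, _ => exact Or.inl rfl
    | .cons h1 .nil, _ => exact Or.inr (Or.inl h1)
    | .cons h1 (.cons h2 .nil), _ => exact Or.inr (Or.inr ⟨_, h1, h2⟩)
    | .cons h1 (.cons h2 (.cons h3 p)), h' => simp at h'
  intro x z hxz
  by_contra hn
  have hnot : ∀ y, Γ.Rel z y → ¬ Γ.graph.Adj x y := fun y hy hxy => hn ⟨y, hy, hxy⟩
  have hN : ∀ y, Γ.Rel z y → ∃ x', Γ.Rel x x' ∧ x' ≠ x ∧ Γ.graph.Adj x' y := by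
    intro y hy
    rcases hdist x y with rfl | hxy | ⟨w, hxw, hwy⟩
    · exact absurd hy.sameType.symm hxz
    · exact absurd hxy (hnot y hy)
    · by_cases ht : Γ.SameType x w
      · exact ⟨w, rel_of_adj hxw ht, hxw.ne', hwy⟩
      · have hyx : ¬ Γ.SameType y x := fun h' => hy.not_sameType hxz h'.symm
        exact absurd hxw (hnot w (h.rel_trans hy (rel_of_adj hwy.symm (sameType_of_not hyx ht))))
  have hopp : ∀ {a b}, Γ.Rel x a → Γ.Rel z b → ¬ Γ.SameType a b := fun ha hb h' =>
    hxz (ha.sameType.trans (h'.trans hb.sameType.symm))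
  have hopp' : ∀ {a b}, Γ.Rel x a → Γ.Rel z b → ¬ Γ.SameType b a := fun ha hb h' =>
    hopp ha hb h'.symm
  obtain ⟨x₁, hx₁, hne₁, ha₁⟩ := hN z (Rel.refl z)
  obtain ⟨x₂, hne₂, hx₁₂, ha₂⟩ := h.exists_partner ha₁.symm (hopp' hx₁ (Rel.refl z))
  have hx₂ := h.rel_trans hx₁ hx₁₂
  obtain ⟨z₂, hnz₂, hz₂, hb₁⟩ := h.exists_partner ha₁ (hopp hx₁ (Rel.refl z))
  have hb₂ : Γ.graph.Adj x₂ z₂ :=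
    h.adj_of_common hx₁₂ ha₁ ha₂.symm hb₁ hz₂ (hopp hx₁ (Rel.refl z))
  obtain ⟨z₃, hz₃, hnz₃, hnz₃'⟩ := h.exists_rel_ne_ne z z z₂
  have hn₁ : ¬ Γ.graph.Adj x₁ z₃ := fun h' => hnz₃'
    (h.partner_unique (hopp hx₁ (Rel.refl z)) ha₁ h' hb₁ hz₃ hz₂ hnz₃ hnz₂)
  have hn₂ : ¬ Γ.graph.Adj x₂ z₃ := fun h' => hnz₃'
    (h.partner_unique (hopp hx₂ (Rel.refl z)) ha₂.symm h' hb₂ hz₃ hz₂ hnz₃ hnz₂)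
  have hn₀ : ¬ Γ.graph.Adj x z₃ := hnot z₃ hz₃
  obtain ⟨x₃, hx₃, hne₃, ha₃⟩ := hN z₃ hz₃
  obtain ⟨x₄, hne₄, hx₃₄, ha₄⟩ := h.exists_partner ha₃.symm (hopp' hx₃ hz₃)
  rcases h.eq_or_of_rel (Rel.refl x) hx₁ hx₂ hx₃ (h.rel_trans hx₃ hx₃₄) hne₁.symm
    (fun h' => hnot z (Rel.refl z) (h' ▸ ha₂.symm)) hne₃.symm hne₂.symm
    (fun h' => hn₁ (h' ▸ ha₃)) (fun h' => hn₂ (h' ▸ ha₃)) with rfl | rfl | rfl | rfl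
  · exact hn₀ ha₄.symm
  · exact hn₁ ha₄.symm
  · exact hn₂ ha₄.symm
  · exact hne₄ rfl

/-! ### Tightness from the condition that `μ` is 3. -/

section Mu

variable (hconn : Γ.graph.Connected)
  (hmu : ∀ u v : V, Γ.graph.dist u v = 2 → Γ.SameType u v → Γ.mu u v = 3)

include hconn hmu

/-- Common neighbors of `u` and `v` are of the other type and lie in distinct classes, since
otherwise `u` and `v` would be adjacent. Being three, they meet all three opposite classes near `u`,
so `v` is near these as well. -/
theorem near_of_not_rel {u v y z : V} (hne : u ≠ v) (hnadj : ¬ Γ.graph.Adj u v)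
    (huv : Γ.SameType u v) (huy : Γ.graph.Adj u y) (hvy : Γ.graph.Adj v y)
    (hz : ¬ Γ.SameType u z) (hn : Γ.Near u z) : Γ.Near v z := by
  have hdist : Γ.graph.dist u v = 2 := by
    have h1 : Γ.graph.dist u v ≤ 2 :=
      SimpleGraph.dist_le (SimpleGraph.Walk.cons huy (SimpleGraph.Walk.cons hvy.symm .nil))
    have h2 := hconn.pos_dist_of_ne hne
    have h3 : Γ.graph.dist u v ≠ 1 := fun h' => hnadj (SimpleGraph.dist_eq_one_iff_adj.1 h')
    omega
  have h3 : Nat.card (Γ.graph.commonNeighbors u v) = 3 := hmu u v hdist huv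
  obtain ⟨l, hul, hl, hll, hcov⟩ := h.exists_three u
  have hopp : ∀ c : Γ.graph.commonNeighbors u v, ¬ Γ.SameType u c := fun c hc =>
    hnadj (h.clique c.2.1.symm c.2.2.symm hc.symm (hc.symm.trans huv) hne)
  choose f hf using fun c : Γ.graph.commonNeighbors u v => hcov c c.2.1 (hopp c)
  have hinj : Function.Injective f := by
    intro c d hcd
    by_contra hne'
    have hrel : Γ.Rel (c : V) d := h.rel_trans (hf c).symm (hcd ▸ hf d)
    have hc' : ¬ Γ.SameType (c : V) u := fun h' => hopp c h'.symm
    have hr := h.rel_of_common hrel (fun h' => hne' (Subtype.ext h')) c.2.1.symm d.2.1.symm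
      c.2.2.symm d.2.2.symm hc' (fun h' => hc' (h'.trans huv.symm))
    exact hnadj (hr.adj hne)
  have hbij := hinj.bijective_of_nat_card_le (by rw [h3]; simp)
  obtain ⟨x, hzx, hux⟩ := hn
  obtain ⟨k, hk⟩ := hcov x hux (hzx.not_sameType hz)
  obtain ⟨c, rfl⟩ := hbij.2 k
  exact ⟨c, h.rel_trans hzx (h.rel_trans hk.symm (hf c)), c.2.2⟩

/-- Only the case of adjacent `u` and `v` is new. A vertex `w` sharing with `y` a neighbor relation
to a point `b` of its class adjacent to neither `u` nor `v` is itself adjacent to neither, so the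
nonadjacent case applies to `u, w` and then to `w, v`. -/
theorem near_of_common {u v y z : V} (huy : Γ.graph.Adj u y) (hvy : Γ.graph.Adj v y)
    (hty : ¬ Γ.SameType u y) (huv : Γ.SameType u v)
    (hz : ¬ Γ.SameType u z) (hn : Γ.Near u z) : Γ.Near v z := by
  by_cases hne : u = v
  · exact hne ▸ hn
  by_cases hadj : Γ.graph.Adj u v
  · have hr : Γ.Rel u v := rel_of_adj hadj huv
    have hyu : ¬ Γ.SameType y u := fun h' => hty h'.symm
    have htv : ¬ Γ.SameType v y := fun h' => hty (huv.trans h')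
    have hyv : ¬ Γ.SameType y v := fun h' => htv h'.symm
    obtain ⟨y₂, hny₂, hyy₂, huy₂⟩ := h.exists_partner huy hty
    have hvy₂ := h.adj_of_common hr huy hvy huy₂ hyy₂ hty
    obtain ⟨b, hyb, hby, hby₂⟩ := h.exists_rel_ne_ne y y y₂
    have hub : ¬ Γ.graph.Adj u b := fun h' =>
      hby₂ (h.partner_unique hty huy h' huy₂ hyb hyy₂ hby hny₂)
    have hvb : ¬ Γ.graph.Adj v b := fun h' =>
      hby₂ (h.partner_unique htv hvy h' hvy₂ hyb hyy₂ hby hny₂)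
    obtain ⟨w, hyw, hbw, htw⟩ := h.exists_common hyb hby.symm
    have huw : Γ.SameType u w := sameType_of_not hty htw
    have hwu : w ≠ u := fun h' => hub (h' ▸ hbw.symm)
    have hwv : w ≠ v := fun h' => hvb (h' ▸ hbw.symm)
    have h1 : ¬ Γ.graph.Adj u w := fun h' => hwv
      (h.partner_unique hyu huy.symm hyw hvy.symm (rel_of_adj h' huw) hr hwu (Ne.symm hne))
    have h2 : ¬ Γ.graph.Adj w v := fun h' => hwu
      (h.partner_unique hyv hvy.symm hyw huy.symm
        (rel_of_adj h'.symm (huv.symm.trans huw)) hr.symm hwv hne)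
    have h3 := h.near_of_not_rel hconn hmu hwu.symm h1 huw huy hyw.symm hz hn
    exact h.near_of_not_rel hconn hmu hwv h2 (huw.symm.trans huv) hyw.symm hvy
      (fun h' => hz (huw.trans h')) h3
  · exact h.near_of_not_rel hconn hmu hne hadj huv huy hvy hz hn

theorem near_of_rel {u v y y' z : V} (huy : Γ.graph.Adj u y) (hvy : Γ.graph.Adj v y')
    (hyy : Γ.Rel y y') (hty : ¬ Γ.SameType u y) (huv : Γ.SameType u v)
    (hz : ¬ Γ.SameType u z) (hn : Γ.Near u z) : Γ.Near v z := by
  by_cases hne : y = y'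
  · subst hne
    exact h.near_of_common hconn hmu huy hvy hty huv hz hn
  · obtain ⟨w, hyw, hyw', htw⟩ := h.exists_common hyy hne
    have huw : Γ.SameType u w := sameType_of_not hty htw
    have h1 := h.near_of_common hconn hmu huy hyw.symm hty huw hz hn
    exact h.near_of_common hconn hmu hyw'.symm hvy
      (fun h' => htw (hyy.sameType.trans h'.symm)) (huw.symm.trans huv)
      (fun h' => hz (huw.trans h')) h1

theorem tight_of_mu : Γ.Tight := by
  intro x z hxz
  -- Induction along a walk from `x` needs both halves: vertices of the type of `x` are near no
  -- class that `x` is not near, and opposite vertices lie in classes near `x`.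
  have key : ∀ v, Relation.ReflTransGen Γ.graph.Adj x v →
      (Γ.SameType x v → ∀ z, ¬ Γ.SameType x z → Γ.Near v z → Γ.Near x z) ∧
        (¬ Γ.SameType x v → Γ.Near x v) := by
    intro v hv
    induction hv with
    | refl => exact ⟨fun _ _ _ h' => h', fun h' => absurd (SameType.refl x) h'⟩
    | @tail v w _ hvw ih =>
      refine ⟨fun hxw z hz hn => ?_, fun hxw => ?_⟩
      · have hwz : ¬ Γ.SameType w z := fun h' => hz (hxw.trans h')
        by_cases hxv : Γ.SameType x v
        · refine ih.1 hxv z hz ?_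
          have hvw' : Γ.SameType v w := hxv.symm.trans hxw
          obtain ⟨b, hvb, hwb, htb⟩ := h.exists_common (rel_of_adj hvw hvw') hvw.ne
          exact h.near_of_common hconn hmu hwb hvb (fun h' => htb (hvw'.trans h')) hvw'.symm hwz hn
        · obtain ⟨y, hy, hxy⟩ := ih.2 hxv
          exact h.near_of_rel hconn hmu hvw.symm hxy hy (fun h' => hxv (hxw.trans h')) hxw.symm
            hwz hn
      · by_cases hxv : Γ.SameType x v
        · exact ih.1 hxv w hxw ⟨w, Rel.refl w, hvw⟩
        · obtain ⟨y, hy, hxy⟩ := ih.2 hxv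
          have hr : Γ.Rel v w :=
            rel_of_adj hvw (sameType_of_not (fun h' => hxv h'.symm) hxw)
          exact ⟨y, h.rel_trans hr.symm hy, hxy⟩
  exact (key z ((SimpleGraph.reachable_iff_reflTransGen x z).1 (hconn.preconnected x z))).2 hxz

end Mu

end IsLocallyF4

end BichromaticGraph

/-! ### Affine coordinates, and the isomorphism with a model. -/

namespace BichromaticGraph

variable {V : Type*} {Γ : BichromaticGraph V}

namespace IsLocallyF4

variable (h : Γ.IsLocallyF4)

include h

/-- Here `p` is the partner of `v` at a neighbor `y₀` in the class of `l`. Another `w` shares no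
neighbor there with `v`, yet by tightness has two, so it takes the complementary pair. -/
theorem exists_parallel (ht : Γ.Tight) {v l : V} (hvl : ¬ Γ.SameType v l) :
    ∃ p, p ≠ v ∧ Γ.Rel v p ∧ (∀ y, Γ.Rel l y → (Γ.graph.Adj p y ↔ Γ.graph.Adj v y)) ∧
      ∀ w, Γ.Rel v w → w ≠ v → w ≠ p → ∀ y, Γ.Rel l y →
        (Γ.graph.Adj w y ↔ ¬ Γ.graph.Adj v y) := by
  obtain ⟨y₀, hly₀, hvy₀⟩ := ht v l hvl
  have hvy₀t : ¬ Γ.SameType v y₀ := hly₀.not_sameType hvl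
  have hy₀v : ¬ Γ.SameType y₀ v := fun h' => hvy₀t h'.symm
  obtain ⟨p, hpv, hvp, hpy₀⟩ := h.exists_partner hvy₀.symm hy₀v
  refine ⟨p, hpv, hvp, fun y hy => ?_, fun w hvw hwv hwp y hy => ?_⟩
  · have hr : Γ.Rel y₀ y := h.rel_trans hly₀.symm hy
    exact ⟨fun h' => h.adj_of_common hvp.symm hpy₀.symm hvy₀ h' hr
      (fun h'' => hvy₀t (hvp.sameType.trans h'')),
      fun h' => h.adj_of_common hvp hvy₀ hpy₀.symm h' hr hvy₀t⟩
  · have hdisj : ∀ y, Γ.Rel l y → Γ.graph.Adj w y → ¬ Γ.graph.Adj v y := by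
      intro y hy hwy hvy
      have h1 := h.adj_of_common hvw hvy hwy hvy₀ (h.rel_trans hy.symm hly₀)
        (hy.not_sameType hvl)
      exact hwp (h.partner_unique hy₀v hvy₀.symm h1.symm hpy₀ hvw hvp hwv hpv)
    refine ⟨hdisj y hy, fun hvy => ?_⟩
    have hwl : ¬ Γ.SameType w l := fun h' => hvl (hvw.sameType.trans h')
    obtain ⟨z, hz, hwz⟩ := ht w l hwl
    obtain ⟨z', hzz', hz', hwz'⟩ := h.exists_partner hwz (hz.not_sameType hwl)
    obtain ⟨y₁, hy₁, hy₀₁, hvy₁⟩ := h.exists_partner hvy₀ hvy₀t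
    have hlz' := h.rel_trans hz hz'
    rcases h.eq_or_of_rel hly₀ (h.rel_trans hly₀ hy₀₁) hz hlz' hy hy₁.symm
      (fun h' => hdisj z hz hwz (h' ▸ hvy₀)) (fun h' => hdisj z' hlz' hwz' (h' ▸ hvy₀))
      (fun h' => hdisj z hz hwz (h' ▸ hvy₁)) (fun h' => hdisj z' hlz' hwz' (h' ▸ hvy₁))
      hzz'.symm with rfl | rfl | rfl | rfl
    · exact absurd hvy₀ hvy
    · exact absurd hvy₁ hvy
    · exact hwz
    · exact hwz'

/-- Affine coordinates on the class of a vertex. -/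
theorem exists_coordinates (ht : Γ.Tight) {v : V} {l : Fin 3 → V}
    (hvl : ∀ j, ¬ Γ.SameType v (l j)) (hl : ∀ j k, Γ.Rel (l j) (l k) → j = k) :
    ∃ P : Bool → Bool → V, (∀ z, Γ.Rel v z ↔ ∃ a b, P a b = z) ∧
      (∀ a b a' b', P a b = P a' b' → a = a' ∧ b = b') ∧
      ∀ a b j y, Γ.Rel (l j) y →
        (Γ.graph.Adj (P a b) y ↔ (Γ.graph.Adj v y ↔ F4.form j a b = false)) := by
  choose p hpv hvp hpy hwy using fun j => h.exists_parallel ht (hvl j)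
  -- The common opposite neighbors of `v` and `p j` lie in one class, so the parallels of `v` for
  -- different classes differ.
  have hpp : ∀ j k, p j = p k → j = k := by
    intro j k hjk
    obtain ⟨y, hy, hvy⟩ := ht v (l j) (hvl j)
    obtain ⟨z, hz, hvz⟩ := ht v (l k) (hvl k)
    have h1 := (hpy j y hy).2 hvy
    have h2 := hjk ▸ (hpy k z hz).2 hvz
    exact hl j k (h.rel_trans hy (h.rel_trans (h.rel_of_common (hvp j) (hpv j).symm hvy h1 hvz h2
      (hy.not_sameType (hvl j)) (hz.not_sameType (hvl k))) hz.symm))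
  have hadj : ∀ j k y, Γ.Rel (l j) y → (Γ.graph.Adj (p k) y ↔ (Γ.graph.Adj v y ↔ j = k)) := by
    intro j k y hy
    by_cases hjk : j = k
    · subst hjk
      simp [hpy j y hy]
    · simp [hwy j (p k) (hvp k) (hpv k) (fun h' => hjk (hpp _ _ h').symm) y hy, hjk]
  have h01 : p 0 ≠ p 1 := fun h' => absurd (hpp _ _ h') (by decide)
  have h02 : p 0 ≠ p 2 := fun h' => absurd (hpp _ _ h') (by decide)
  have h12 : p 1 ≠ p 2 := fun h' => absurd (hpp _ _ h') (by decide)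
  -- The origin is `v`, and `p j` is placed at the nonzero zero of the form with index `j`.
  refine ⟨fun a b => match a, b with
    | false, false => v
    | false, true => p 0
    | true, false => p 1
    | true, true => p 2, fun z => ⟨fun hz => ?_, ?_⟩, ?_, ?_⟩
  · rcases h.eq_or_of_rel (Rel.refl v) (hvp 0) (hvp 1) (hvp 2) hz (hpv 0).symm (hpv 1).symm
      (hpv 2).symm h01 h02 h12 with rfl | rfl | rfl | rfl
    · exact ⟨false, false, rfl⟩
    · exact ⟨false, true, rfl⟩
    · exact ⟨true, false, rfl⟩
    · exact ⟨true, true, rfl⟩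
  · rintro ⟨_ | _, _ | _, rfl⟩
    · exact Rel.refl v
    · exact hvp 0
    · exact hvp 1
    · exact hvp 2
  · rintro (_ | _) (_ | _) (_ | _) (_ | _) h' <;>
      simp_all [(hpv _).symm, h12.symm]
  · rintro (_ | _) (_ | _) j y hy
    · fin_cases j <;> simp [F4.form]
    · rw [hadj j 0 y hy]; fin_cases j <;> simp [F4.form]
    · rw [hadj j 1 y hy]; fin_cases j <;> simp [F4.form]
    · rw [hadj j 2 y hy]; fin_cases j <;> simp [F4.form]

theorem exists_representatives (ht : Γ.Tight) (v : V) : ∃ l : Fin 3 → V,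
    (∀ k, ¬ Γ.SameType v (l k)) ∧ (∀ j k, Γ.Rel (l j) (l k) → j = k) ∧
    ∀ z, ¬ Γ.SameType v z → ∃ k, Γ.Rel (l k) z := by
  obtain ⟨l, -, hl, hll, hcov⟩ := h.exists_three v
  refine ⟨l, hl, hll, fun z hz => ?_⟩
  obtain ⟨y, hy, hvy⟩ := ht v z hz
  obtain ⟨k, hk⟩ := hcov y hvy (hy.not_sameType hz)
  exact ⟨k, h.rel_trans hk hy.symm⟩

theorem isIsomorphic_model (ht : Γ.Tight) [hV : Nonempty V] :
    ∃ c : Fin 3 → Fin 3 → Bool, Γ.IsIsomorphic (F4.model c) := by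
  classical
  obtain ⟨x, hx⟩ : ∃ x, Γ.IsShort x := by
    obtain ⟨v⟩ := hV
    by_cases hv : Γ.IsShort v
    · exact ⟨v, hv⟩
    · obtain ⟨w, hw⟩ := h.exists_opposite v
      refine ⟨w, ?_⟩
      by_contra hw'
      exact hw (iff_of_false hv hw')
  obtain ⟨l, hl, hll, hlcov⟩ := h.exists_representatives ht x
  have hlong : ∀ j, ¬ Γ.IsShort (l j) := fun j hj => hl j (iff_of_true hx hj)
  obtain ⟨s, hs, hss, hscov⟩ := h.exists_representatives ht (l 0)
  have hshort : ∀ i, Γ.IsShort (s i) := fun i => by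
    by_contra hi
    exact hs i (iff_of_false (hlong 0) hi)
  have hsl : ∀ i j, ¬ Γ.SameType (s i) (l j) := fun i j h' => hlong j (h'.1 (hshort i))
  choose P hP hPinj hPadj using fun i => h.exists_coordinates ht (hsl i) hll
  choose Q hQ hQinj hQadj using fun j => h.exists_coordinates ht
    (fun i h' => hsl i j h'.symm) hss
  have hPr : ∀ i a b, Γ.Rel (s i) (P i a b) := fun i a b => (hP i _).2 ⟨a, b, rfl⟩
  have hQr : ∀ j a b, Γ.Rel (l j) (Q j a b) := fun j a b => (hQ j _).2 ⟨a, b, rfl⟩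
  have hPs : ∀ i a b, Γ.IsShort (P i a b) := fun i a b => (hPr i a b).sameType.1 (hshort i)
  have hQs : ∀ i a b, ¬ Γ.IsShort (Q i a b) := fun i a b h' =>
    hlong i ((hQr i a b).sameType.2 h')
  have hPP : ∀ i a b j a' b', Γ.Rel (P i a b) (P j a' b') → i = j := fun i a b j a' b' h' =>
    hss i j (h.rel_trans (hPr i a b) (h.rel_trans h' (hPr j a' b').symm))
  have hQQ : ∀ i a b j a' b', Γ.Rel (Q i a b) (Q j a' b') → i = j := fun i a b j a' b' h' =>
    hll i j (h.rel_trans (hQr i a b) (h.rel_trans h' (hQr j a' b').symm))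
  let F : F4.Model → V := fun m => match m with
    | (true, i, a, b) => P i a b
    | (false, i, a, b) => Q i a b
  have hFs : ∀ m, Γ.IsShort (F m) ↔ m.1 = true := by
    rintro ⟨_ | _, i, a, b⟩
    · simpa using hQs i a b
    · simpa using hPs i a b
  have hFinj : Function.Injective F := by
    rintro ⟨_ | _, i, a, b⟩ ⟨_ | _, j, a', b'⟩ hF
    · have hF' : Q i a b = Q j a' b' := hF
      obtain rfl := hQQ i a b j a' b' (hF' ▸ Rel.refl _)
      obtain ⟨rfl, rfl⟩ := hQinj i _ _ _ _ hF'
      rfl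
    · exact absurd (hPs j a' b') (by
        have hF' : Q i a b = P j a' b' := hF
        rw [← hF']
        exact hQs i a b)
    · exact absurd (hPs i a b) (by
        have hF' : P i a b = Q j a' b' := hF
        rw [hF']
        exact hQs j a' b')
    · have hF' : P i a b = P j a' b' := hF
      obtain rfl := hPP i a b j a' b' (hF' ▸ Rel.refl _)
      obtain ⟨rfl, rfl⟩ := hPinj i _ _ _ _ hF'
      rfl
  have hFsurj : Function.Surjective F := by
    intro z
    by_cases hz : Γ.IsShort z
    · obtain ⟨i, hi⟩ := hscov z (fun h' => hlong 0 (h'.2 hz))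
      obtain ⟨a, b, rfl⟩ := (hP i z).1 hi
      exact ⟨(true, i, a, b), rfl⟩
    · obtain ⟨i, hi⟩ := hlcov z (fun h' => hz (h'.1 hx))
      obtain ⟨a, b, rfl⟩ := (hQ i z).1 hi
      exact ⟨(false, i, a, b), rfl⟩
  -- The forms vanish at the origins `s i` and `l j`, so these are adjacent exactly when the entry
  -- is `false`.
  let c : Fin 3 → Fin 3 → Bool := fun i j => !decide (Γ.graph.Adj (s i) (l j))
  have hcross : ∀ i a b j a' b', Γ.graph.Adj (P i a b) (Q j a' b') ↔
      F4.modelAdj c (true, i, a, b) (false, j, a', b') = true := by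
    intro i a b j a' b'
    have h1 : Γ.graph.Adj (s i) (Q j a' b') ↔
        (Γ.graph.Adj (s i) (l j) ↔ F4.form i a' b' = false) := by
      rw [SimpleGraph.adj_comm, hQadj j a' b' i (s i) (Rel.refl _), SimpleGraph.adj_comm]
    rw [hPadj i a b j _ (hQr j a' b'), h1]
    simp only [F4.modelAdj, c]
    by_cases hadj : Γ.graph.Adj (s i) (l j) <;> simp only [hadj] <;>
      cases F4.form i a' b' <;> cases F4.form j a b <;> simp
  have hFadj : ∀ m n, Γ.graph.Adj (F m) (F n) ↔ F4.modelAdj c m n = true := by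
    rintro ⟨_ | _, i, a, b⟩ ⟨_ | _, j, a', b'⟩
    · change Γ.graph.Adj (Q i a b) (Q j a' b') ↔ _
      have hst : Γ.SameType (Q i a b) (Q j a' b') := iff_of_false (hQs _ _ _) (hQs _ _ _)
      constructor
      · intro hadj
        obtain rfl := hQQ i a b j a' b' (rel_of_adj hadj hst)
        have hne : ¬ (a = a' ∧ b = b') := fun h' => hadj.ne (by rw [h'.1, h'.2])
        simpa [F4.modelAdj, ← not_and_or] using hne
      · intro hadj
        simp only [F4.modelAdj, Bool.and_eq_true, beq_iff_eq] at hadj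
        obtain ⟨rfl, hne⟩ := hadj
        refine (h.rel_trans (hQr i a b).symm (hQr i a' b')).adj fun h' => ?_
        obtain ⟨rfl, rfl⟩ := hQinj i _ _ _ _ h'
        simp at hne
    · rw [SimpleGraph.adj_comm, F4.modelAdj_comm]
      exact hcross j a' b' i a b
    · exact hcross i a b j a' b'
    · change Γ.graph.Adj (P i a b) (P j a' b') ↔ _
      have hst : Γ.SameType (P i a b) (P j a' b') := iff_of_true (hPs _ _ _) (hPs _ _ _)
      constructor
      · intro hadj
        obtain rfl := hPP i a b j a' b' (rel_of_adj hadj hst)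
        have hne : ¬ (a = a' ∧ b = b') := fun h' => hadj.ne (by rw [h'.1, h'.2])
        simpa [F4.modelAdj, ← not_and_or] using hne
      · intro hadj
        simp only [F4.modelAdj, Bool.and_eq_true, beq_iff_eq] at hadj
        obtain ⟨rfl, hne⟩ := hadj
        refine (h.rel_trans (hPr i a b).symm (hPr i a' b')).adj fun h' => ?_
        obtain ⟨rfl, rfl⟩ := hPinj i _ _ _ _ h'
        simp at hne
  have hiso : (F4.model c).IsIsomorphic Γ :=
    ⟨⟨Equiv.ofBijective F ⟨hFinj, hFsurj⟩, fun {m n} => hFadj m n⟩, hFs⟩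
  exact ⟨c, hiso.symm⟩

end IsLocallyF4

end BichromaticGraph

end

theorem mainTheorem3 {V : Type*} (Γ : BichromaticGraph V)
    (hconn : Γ.graph.Connected)
    (hloc : Γ.LocallyLike F4.weylGraph)
    (htight : Nat.card V = 24 ∨
      Γ.TightlyConnected ∨
      Γ.graph.ediam = 2 ∨
      (∀ u v : V, Γ.graph.dist u v = 2 → Γ.SameType u v → Γ.mu u v = 3)) :
    (Γ.IsIsomorphic F4.weylGraph ∨ Γ.IsIsomorphic F4.twistedWeylGraph) ∧
      Nonempty (Γ.aut ≃* (F4.weylGroup ⧸ Subgroup.center F4.weylGroup)) := by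
  have h := F4.isLocallyF4_of_locallyLike hloc
  have ht : Γ.Tight := by
    rcases htight with h24 | htc | hdiam | hmu
    · exact h.tight_of_card h24
    · exact h.tight_of_tightlyConnected htc
    · exact h.tight_of_ediam hdiam
    · exact h.tight_of_mu hconn hmu
  have := hconn.nonempty
  obtain ⟨c, hc⟩ := h.isIsomorphic_model ht
  have hc' := hc.trans (F4.model_isIsomorphic_const c)
  obtain ⟨φ⟩ := F4.model_isIsomorphic_weylGraph.aut_mulEquiv
  obtain ⟨ψ⟩ := F4.aut_weylGraph_mulEquiv
  obtain ⟨χ⟩ := hc'.aut_mulEquiv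
  rcases hp : F4.parity c with _ | _
  · rw [hp] at hc' χ
    exact ⟨Or.inl (hc'.trans F4.model_isIsomorphic_weylGraph), ⟨χ.trans (φ.trans ψ)⟩⟩
  · rw [hp] at hc' χ
    -- The twisted case borrows the automorphism group of the Weyl graph through complementation.
    obtain ⟨θ⟩ := F4.aut_model_const_mulEquiv
    exact ⟨Or.inr (hc'.trans F4.twistedWeylGraph_isIsomorphic_model.symm),
      ⟨χ.trans (θ.trans (φ.trans ψ))⟩⟩
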